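/- Let $d\ge 1$ be an integer and $q,u\in\mathbb{C}\setminus\{0\}$. Let $B_n$ be the braid group on $n$ strands, with the standard generators $\sigma_1,\dots,\sigma_{n-1}$. **Algebras.** $\mathcal{H}_n(q)$ is the associative unital $\mathbb{C}$-algebra generated by $G_1,\dots,G_{n-1}$ subject to the braid relations $G_iG_j=G_jG_i$ ($|i-j|>1$), $G_iG_{i+1}G_i=G_{i+1}G_iG_{i+1}$ and the quadratic relations $G_i^2=(q-1)G_i+q$. The Yokonuma-Hecke algebra ${\rm Y}_{d,n}(u)$ is the associative unital $\mathbb{C}$-algebra generated by $g_1,\dots,g_{n-1},t_1,\dots,t_n$ subject to the braid relations for the $g_i$, the relations $t_it_j=t_jt_i$, $t_j^d=1$, $t_jg_i=g_it_{s_i(j)}$ (where $s_i$ is the transposition $(i,\,i+1)$), and $$g_i^2=1+(u-1)e_i+(u-1)e_ig_i,\qquad e_i=\frac1d\sum_{s=0}^{d-1}t_i^st_{i+1}^{-s}.$$ Set $\mathcal H_0(q)={\rm Y}_{d,0}(u)=\mathbb{C}$. The $n$-th algebra of each family is regarded as a subalgebra of the $(n+1)$-st through the natural inclusion. Let $\pi:\mathbb{C}B_n\to\mathcal{H}_n(q)$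 and $\delta:\mathbb{C}B_n\to{\rm Y}_{d,n}(u)$ be the algebra homomorphisms with $\pi(\sigma_i)=G_i$ and $\delta(\sigma_i)=g_i$. **Traces.** The Ocneanu trace with parameter $\zeta$ is the unique linear map $\tau:\bigcup_{n\ge0}\mathcal{H}_n(q)\to\mathbb{C}[\zeta]$ such that $\tau(hh')=\tau(h'h)$, $\tau(1)=1$, and $\tau(hG_n)=\zeta\,\tau(h)$ for all $n\ge1$ and $h\in\mathcal{H}_n(q)$. The Juyumaya trace is the unique linear map ${\rm tr}:\bigcup_{n\ge0}{\rm Y}_{d,n}(u)\to\mathbb{C}[z,x_1,\dots,x_{d-1}]$ such that ${\rm tr}(ab)={\rm tr}(ba)$, ${\rm tr}(1)=1$, ${\rm tr}(ag_n)=z\,{\rm tr}(a)$ for $n\ge1$ and $a\in{\rm Y}_{d,n}(u)$, and ${\rm tr}(at_{n+1}^m)=x_m\,{\rm tr}(a)$ for $n\ge0$, $a\in{\rm Y}_{d,n}(u)$ and $1\le m\le d-1$. **E-system.** With $x_0:=1$ and indices modulo $d$, complex numbers ${\rm x}_1,\dots,{\rm x}_{d-1}$ form a solution of the E-system if $$\sum_{s=0}^{d-1}{\rm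 x}_{m+s}{\rm x}_{d-s}={\rm x}_m\sum_{s=0}^{d-1}{\rm x}_s{\rm x}_{d-s}\qquad(1\le m\le d-1).$$ For a solution $X_S=\{{\rm x}_1,\dots,{\rm x}_{d-1}\}$ (the solutions are parametrized by the non-empty subsets $S$ of $\mathbb{Z}/d\mathbb{Z}$), put $E=\frac1d\sum_{s=0}^{d-1}{\rm x}_s{\rm x}_{d-s}$, and let ${\rm tr}_S=\theta\circ{\rm tr}$ be the specialized Juyumaya trace, where $\theta:\mathbb{C}[z,x_1,\dots,x_{d-1}]\to\mathbb{C}[z]$ is the algebra homomorphism with $\theta(z)=z$ and $\theta(x_m)={\rm x}_m$. **Proposition.** Let $X_S$ be a solution of the E-system with $E=1$. If $u=q$ and $z=\zeta$ (that is, the two polynomial rings $\mathbb{C}[z]$ and $\mathbb{C}[\zeta]$ are identified by $z=\zeta$), then $$\tau(\pi(\alpha))={\rm tr}_S(\delta(\alpha))\qquad\text{for all } n\in\mathbb{N}\text{ and all }\alpha\in B_n .$$ -/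

import Mathlib

noncomputable section

namespace YokonumaHecke

set_option linter.unusedSectionVars false
set_option linter.unusedSimpArgs false

/- The main definitions are: BraidGroup, Hecke, Y (presentations by generators and relations);
IsOcneanuTrace and IsJuyumayaTrace (the rules of the two traces), ocneanuTrace and
juyumayaTrace; extParam, paramE and IsESolution (the E-system); specMap and specTrace (the
specialized trace); piMap and deltaMap (the natural maps from the group algebra of the braid
group). All other material proves that these objects exist: it constructs the trace inductively
on the algebras, through a representation that gives a module decomposition of each algebra
over the previous one. -/

/-- The left strand `i` met by the `i`-th braiding generator. -/
def lo {n : ℕ} (i : Fin (n - 1)) : Fin n := ⟨i, by omega⟩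

/-- The right strand `i + 1` met by the `i`-th braiding generator. -/
def hi {n : ℕ} (i : Fin (n - 1)) : Fin n := ⟨i + 1, by omega⟩

/-- The defining relators of the braid group. -/
inductive BraidRel (n : ℕ) : FreeGroup (Fin (n - 1)) → Prop
  | far (i j : Fin (n - 1)) (h : (i : ℕ) + 1 < j) :
      BraidRel n (FreeGroup.of i * FreeGroup.of j * (FreeGroup.of j * FreeGroup.of i)⁻¹)
  | braid (i j : Fin (n - 1)) (h : (j : ℕ) = i + 1) :
      BraidRel n (FreeGroup.of j * FreeGroup.of i * FreeGroup.of j *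
        (FreeGroup.of i * FreeGroup.of j * FreeGroup.of i)⁻¹)

/-- The Artin braid group `B_n` on `n` strands. -/
def BraidGroup (n : ℕ) : Type := PresentedGroup {r | BraidRel n r}

instance (n : ℕ) : Group (BraidGroup n) :=
  inferInstanceAs (Group (PresentedGroup {r | BraidRel n r}))

/-- The braid generators. -/
def σ {n : ℕ} (i : Fin (n - 1)) : BraidGroup n := PresentedGroup.of i

/-- The defining relations of the Iwahori-Hecke algebra. -/
inductive HeckeRel (n : ℕ) (q : ℂ) :
    FreeAlgebra ℂ (Fin (n - 1)) → FreeAlgebra ℂ (Fin (n - 1)) → Prop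
  | far (i j : Fin (n - 1)) (h : (i : ℕ) + 1 < j) :
      HeckeRel n q (FreeAlgebra.ι ℂ i * FreeAlgebra.ι ℂ j) (FreeAlgebra.ι ℂ j * FreeAlgebra.ι ℂ i)
  | braid (i j : Fin (n - 1)) (h : (j : ℕ) = i + 1) :
      HeckeRel n q (FreeAlgebra.ι ℂ j * FreeAlgebra.ι ℂ i * FreeAlgebra.ι ℂ j)
        (FreeAlgebra.ι ℂ i * FreeAlgebra.ι ℂ j * FreeAlgebra.ι ℂ i)
  | quad (i : Fin (n - 1)) :
      HeckeRel n q (FreeAlgebra.ι ℂ i ^ 2)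
        ((q - 1) • FreeAlgebra.ι ℂ i + algebraMap ℂ _ q)

/-- The Iwahori-Hecke algebra `H_n(q)` of type `A`. -/
def Hecke (n : ℕ) (q : ℂ) : Type := RingQuot (HeckeRel n q)

instance (n : ℕ) (q : ℂ) : Ring (Hecke n q) := inferInstanceAs (Ring (RingQuot (HeckeRel n q)))
instance (n : ℕ) (q : ℂ) : Algebra ℂ (Hecke n q) :=
  inferInstanceAs (Algebra ℂ (RingQuot (HeckeRel n q)))

def Hecke.mk (n : ℕ) (q : ℂ) : FreeAlgebra ℂ (Fin (n - 1)) →ₐ[ℂ] Hecke n q :=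
  RingQuot.mkAlgHom ℂ (HeckeRel n q)

/-- The generators `G_i` of the Iwahori-Hecke algebra. -/
def Hecke.G {n : ℕ} (q : ℂ) (i : Fin (n - 1)) : Hecke n q := Hecke.mk n q (FreeAlgebra.ι ℂ i)

/-- For `a ^ d = b ^ d = 1` this is the average `(1/d) ∑ a ^ s b ^ (-s)`. -/
def idem (d : ℕ) {A : Type*} [Ring A] [Algebra ℂ A] (a b : A) : A :=
  (d : ℂ)⁻¹ • ∑ s ∈ Finset.range d, a ^ s * b ^ (d - s)

/-- Names of the generators of the Yokonuma-Hecke algebra. -/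
inductive YGen (n : ℕ) : Type
  | g (i : Fin (n - 1)) : YGen n
  | t (j : Fin n) : YGen n

/-- The generator `g_i` in the free algebra. -/
abbrev fg {n : ℕ} (i : Fin (n - 1)) : FreeAlgebra ℂ (YGen n) := FreeAlgebra.ι ℂ (YGen.g i)

/-- The generator `t_j` in the free algebra. -/
abbrev ft {n : ℕ} (j : Fin n) : FreeAlgebra ℂ (YGen n) := FreeAlgebra.ι ℂ (YGen.t j)

/-- The defining relations of the Yokonuma-Hecke algebra. -/
inductive YRel (d n : ℕ) (u : ℂ) : FreeAlgebra ℂ (YGen n) → FreeAlgebra ℂ (YGen n) → Prop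
  | far (i j : Fin (n - 1)) (h : (i : ℕ) + 1 < j) : YRel d n u (fg i * fg j) (fg j * fg i)
  | braid (i j : Fin (n - 1)) (h : (j : ℕ) = i + 1) :
      YRel d n u (fg i * fg j * fg i) (fg j * fg i * fg j)
  | tt (i j : Fin n) : YRel d n u (ft i * ft j) (ft j * ft i)
  | tg (i : Fin (n - 1)) (j : Fin n) :
      YRel d n u (ft j * fg i) (fg i * ft (Equiv.swap (lo i) (hi i) j))
  | td (j : Fin n) : YRel d n u (ft j ^ d) 1
  | quad (i : Fin (n - 1)) :
      YRel d n u (fg i ^ 2)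
        (1 + (u - 1) • idem d (ft (lo i)) (ft (hi i)) +
          (u - 1) • (idem d (ft (lo i)) (ft (hi i)) * fg i))

/-- The Yokonuma-Hecke algebra `Y_{d,n}(u)`. -/
def Y (d n : ℕ) (u : ℂ) : Type := RingQuot (YRel d n u)

instance (d n : ℕ) (u : ℂ) : Ring (Y d n u) := inferInstanceAs (Ring (RingQuot (YRel d n u)))
instance (d n : ℕ) (u : ℂ) : Algebra ℂ (Y d n u) :=
  inferInstanceAs (Algebra ℂ (RingQuot (YRel d n u)))

def Y.mk (d n : ℕ) (u : ℂ) : FreeAlgebra ℂ (YGen n) →ₐ[ℂ] Y d n u :=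
  RingQuot.mkAlgHom ℂ (YRel d n u)

/-- The braiding generators `g_i` of `Y_{d,n}(u)`. -/
def Y.g (d : ℕ) {n : ℕ} (u : ℂ) (i : Fin (n - 1)) : Y d n u := Y.mk d n u (fg i)

/-- The framing generators `t_j` of `Y_{d,n}(u)`. -/
def Y.t (d : ℕ) {n : ℕ} (u : ℂ) (j : Fin n) : Y d n u := Y.mk d n u (ft j)

section idemLemmas

variable {A : Type*} [Ring A] [Algebra ℂ A] {d : ℕ}

theorem map_idem {B : Type*} [Ring B] [Algebra ℂ B] (f : A →ₐ[ℂ] B) (a b : A) :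
    f (idem d a b) = idem d (f a) (f b) := by
  simp [idem, map_sum]

/-- Powers with exponents in `ℤ/d`. -/
def pz (a : A) (k : ZMod d) : A := a ^ k.val

theorem pz_natCast {a : A} (ha : a ^ d = 1) (k : ℕ) : pz a (k : ZMod d) = a ^ k := by
  rw [pz, ZMod.val_natCast, ← pow_eq_pow_mod _ ha]

theorem pz_add [NeZero d] {a : A} (ha : a ^ d = 1) (k l : ZMod d) :
    pz a (k + l) = pz a k * pz a l := by
  rw [pz, ZMod.val_add, ← pow_eq_pow_mod _ ha, pow_add, pz, pz]

@[simp] theorem pz_zero {a : A} : pz a (0 : ZMod d) = 1 := by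
  simp [pz]

theorem pz_swap {a a' y : A} (h : a * y = y * a') (k : ZMod d) : pz a k * y = y * pz a' k :=
  (SemiconjBy.pow_right (show SemiconjBy y a' a from h.symm) k.val).symm

theorem idem_eq [NeZero d] {a b : A} (hb : b ^ d = 1) :
    idem d a b = (d : ℂ)⁻¹ • ∑ k : ZMod d, pz a k * pz b (-k) := by
  unfold idem
  congr 1
  refine Finset.sum_bij' (fun s _ => (s : ZMod d)) (fun k _ => k.val) ?_ ?_ ?_ ?_ ?_
  · simp
  · intro k _
    simpa using ZMod.val_lt k
  · intro s hs
    simpa using ZMod.val_cast_of_lt (by simpa using hs)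
  · simp
  · intro s hs
    have hs : s < d := by simpa using hs
    have h1 : (-(s : ZMod d)) = ((d - s : ℕ) : ZMod d) := by
      rw [Nat.cast_sub hs.le]; simp
    rw [h1, pz_natCast hb, pz, ZMod.val_cast_of_lt hs]

theorem idem_comm [NeZero d] {a b : A} (ha : a ^ d = 1) (hb : b ^ d = 1) (h : a * b = b * a) :
    idem d a b = idem d b a := by
  rw [idem_eq hb, idem_eq ha]
  congr 1
  refine Finset.sum_bij' (fun s _ => -s) (fun s _ => -s) ?_ ?_ ?_ ?_ ?_ <;> simp
  intro k
  exact Commute.pow_pow h _ _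

theorem idem_swap {a b a' b' y : A} (ha : a * y = y * a') (hb : b * y = y * b') :
    idem d a b * y = y * idem d a' b' := by
  have h1 : SemiconjBy y a' a := ha.symm
  have h2 : SemiconjBy y b' b := hb.symm
  simp only [idem, smul_mul_assoc, mul_smul_comm, Finset.sum_mul, Finset.mul_sum]
  congr 1
  refine Finset.sum_congr rfl fun s _ => ?_
  exact ((h1.pow_right s).mul_right (h2.pow_right (d - s))).symm

theorem idem_mul [NeZero d] {a b c : A} (hb : b ^ d = 1) (hc : c ^ d = 1)
    (hab : a * b = b * a) (hac : a * c = c * a) (hbc : b * c = c * b) :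
    idem d a c * idem d b c = idem d b c * idem d a b := by
  rw [idem_eq hb, idem_eq hc, idem_eq hc]
  rw [smul_mul_smul_comm, smul_mul_smul_comm, Finset.sum_mul_sum, Finset.sum_mul_sum]
  congr 1
  conv_rhs => rw [Finset.sum_comm]
  refine Finset.sum_congr rfl fun s _ => ?_
  refine Finset.sum_bij' (fun r _ => r + s) (fun r _ => r - s) ?_ ?_ ?_ ?_ ?_ <;> simp
  intro r
  have c1 : Commute (pz (d := d) a s) (pz (d := d) c (-s)) := Commute.pow_pow hac _ _
  have c2 : Commute (pz (d := d) a s) (pz (d := d) b r) := Commute.pow_pow hab _ _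
  have c3 : Commute (pz (d := d) a s) (pz (d := d) b s) := Commute.pow_pow hab _ _
  have c4 : Commute (pz (d := d) a s) (pz (d := d) c (-r)) := Commute.pow_pow hac _ _
  have c5 : Commute (pz (d := d) b (-s)) (pz (d := d) c (-s)) := Commute.pow_pow hbc _ _
  have c6 : Commute (pz (d := d) b (-s)) (pz (d := d) c (-r)) := Commute.pow_pow hbc _ _
  have c7 : Commute (pz (d := d) b r) (pz (d := d) c (-s)) := Commute.pow_pow hbc _ _
  have c8 : Commute (pz (d := d) b (-s)) (pz (d := d) a s) := Commute.pow_pow hab.symm _ _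
  have c9 : Commute (pz (d := d) c (-r)) (pz (d := d) c (-s)) := Commute.pow_pow rfl _ _
  have e1 : pz b s * pz b (-s) = 1 := by rw [← pz_add hb]; simp
  rw [pz_add hb, add_comm (-s) (-r), pz_add hc]
  calc pz a s * pz c (-s) * (pz b r * pz c (-r))
      = pz b r * (pz c (-r) * pz c (-s)) * pz a s := by
        rw [c9.eq, c1.eq, mul_assoc, ← mul_assoc (pz a s), c2.eq, mul_assoc, c4.eq,
          ← mul_assoc, ← c7.eq]
        simp only [mul_assoc]
    _ = _ := by
        have h3 : pz b (-s) * (pz c (-r) * pz c (-s)) = (pz c (-r) * pz c (-s)) * pz b (-s) :=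
          (c6.mul_right c5).eq
        have : pz b s * (pz c (-r) * pz c (-s)) * (pz a s * pz b (-s)) 
           = (pz c (-r) * pz c (-s)) * pz a s := by
          rw [← c8.eq, mul_assoc, ← mul_assoc _ (pz b (-s)), ← h3]
          simp only [← mul_assoc, e1, one_mul]
        rw [mul_assoc (pz b r), mul_assoc (pz b r), mul_assoc (pz b r), this, mul_assoc]

theorem idem_mul_self [NeZero d] {a b : A} (ha : a ^ d = 1) (hb : b ^ d = 1) (h : a * b = b * a) :
    idem d a b * a = idem d a b * b := by
  have h1 : pz a (1 : ZMod d) = a := by simpa using pz_natCast ha 1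
  have h2 : pz b (1 : ZMod d) = b := by simpa using pz_natCast hb 1
  rw [idem_eq hb, smul_mul_assoc, smul_mul_assoc, Finset.sum_mul, Finset.sum_mul]
  congr 1
  refine Finset.sum_bij' (fun s _ => s + 1) (fun s _ => s - 1) ?_ ?_ ?_ ?_ ?_ <;> simp
  intro k
  have c : Commute (pz (d := d) b (-k)) a := Commute.pow_left h.symm _
  rw [mul_assoc, c.eq, ← mul_assoc, pz_add ha, h1, mul_assoc (pz a k * a)]
  congr 1
  have h3 := pz_add hb (-1 + -k) 1
  rw [h2] at h3
  simp [← h3]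

end idemLemmas

/-- Elements of an algebra satisfying the relations of `Y_{d,n}(u)`. -/
structure YRep (d n : ℕ) (u : ℂ) {A : Type*} [Ring A] [Algebra ℂ A] (G T : ℕ → A) : Prop where
  far : ∀ i j, i + 1 < j → j + 1 < n → G i * G j = G j * G i
  braid : ∀ i, i + 2 < n → G i * G (i + 1) * G i = G (i + 1) * G i * G (i + 1)
  tt : ∀ i j, i < n → j < n → T i * T j = T j * T i
  tg : ∀ i j, i + 1 < n → j < n → j ≠ i → j ≠ i + 1 → T j * G i = G i * T j
  tg0 : ∀ i, i + 1 < n → T i * G i = G i * T (i + 1)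
  tg1 : ∀ i, i + 1 < n → T (i + 1) * G i = G i * T i
  td : ∀ j, j < n → T j ^ d = 1
  quad : ∀ i, i + 1 < n → G i * G i =
    1 + (u - 1) • idem d (T i) (T (i + 1)) + (u - 1) • (idem d (T i) (T (i + 1)) * G i)

theorem YRep.mono {d n m : ℕ} {u : ℂ} {A : Type*} [Ring A] [Algebra ℂ A] {G T : ℕ → A}
    (h : YRep d n u G T) (hm : m ≤ n) : YRep d m u G T where
  far i j h1 h2 := h.far i j h1 (by omega)
  braid i h1 := h.braid i (by omega)
  tt i j h1 h2 := h.tt i j (by omega) (by omega)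
  tg i j h1 h2 h3 h4 := h.tg i j (by omega) (by omega) h3 h4
  tg0 i h1 := h.tg0 i (by omega)
  tg1 i h1 := h.tg1 i (by omega)
  td i h1 := h.td i (by omega)
  quad i h1 := h.quad i (by omega)

theorem YRep.map {d n : ℕ} {u : ℂ} {A B : Type*} [Ring A] [Algebra ℂ A] [Ring B] [Algebra ℂ B]
    {G T : ℕ → A} (h : YRep d n u G T) (f : A →ₐ[ℂ] B) :
    YRep d n u (fun i => f (G i)) (fun j => f (T j)) where
  far i j h1 h2 := by simp only [← map_mul, h.far i j h1 h2]
  braid i h1 := by simp only [← map_mul, h.braid i h1]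
  tt i j h1 h2 := by simp only [← map_mul, h.tt i j h1 h2]
  tg i j h1 h2 h3 h4 := by simp only [← map_mul, h.tg i j h1 h2 h3 h4]
  tg0 i h1 := by simp only [← map_mul, h.tg0 i h1]
  tg1 i h1 := by simp only [← map_mul, h.tg1 i h1]
  td i h1 := by simp only [← map_pow, h.td i h1, map_one]
  quad i h1 := by
    simp only [← map_mul, h.quad i h1, map_add, map_one, ← map_idem, map_smul]

theorem Y.swap_cases {n : ℕ} (i : Fin (n - 1)) (j : Fin n) :
    (j = lo i ∧ Equiv.swap (lo i) (hi i) j = hi i) ∨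
    (j = hi i ∧ Equiv.swap (lo i) (hi i) j = lo i) ∨
    (j ≠ lo i ∧ j ≠ hi i ∧ Equiv.swap (lo i) (hi i) j = j) := by
  by_cases h1 : j = lo i
  · simp [h1]
  by_cases h2 : j = hi i
  · simp [h2]
  exact Or.inr (Or.inr ⟨h1, h2, Equiv.swap_apply_of_ne_of_ne h1 h2⟩)

/-- The algebra map out of `Y_{d,n}(u)` given by elements satisfying the relations. -/
def Y.lift {d n : ℕ} {u : ℂ} {A : Type*} [Ring A] [Algebra ℂ A] {G T : ℕ → A}
    (h : YRep d n u G T) : Y d n u →ₐ[ℂ] A :=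
  RingQuot.liftAlgHom ℂ ⟨FreeAlgebra.lift ℂ fun x => match x with
    | YGen.g i => G i
    | YGen.t j => T j, by
    intro x y hxy
    cases hxy with
    | far i j hij => simpa using h.far i j hij (by omega)
    | braid i j hij => simpa [hij] using h.braid i (by omega)
    | tt i j => simpa using h.tt i j i.2 j.2
    | tg i j =>
      rcases Y.swap_cases i j with ⟨h1, h2⟩ | ⟨h1, h2⟩ | ⟨h1, h2, h3⟩
      · rw [h2, h1]; simpa [lo, hi] using h.tg0 i (by omega)
      · rw [h2, h1]; simpa [lo, hi] using h.tg1 i (by omega)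
      · rw [h3]
        simpa using h.tg i j (by omega) j.2 (fun e => h1 (Fin.ext e)) (fun e => h2 (Fin.ext e))
    | td j => simpa using h.td j j.2
    | quad i =>
      simpa [map_idem, pow_two, lo, hi] using h.quad i (by omega)⟩

@[simp] theorem Y.lift_g {d n : ℕ} {u : ℂ} {A : Type*} [Ring A] [Algebra ℂ A] {G T : ℕ → A}
    (h : YRep d n u G T) (i : Fin (n - 1)) : Y.lift h (Y.g d u i) = G i := by
  simp only [Y.lift, Y.g, Y.mk]
  erw [RingQuot.liftAlgHom_mkAlgHom_apply]
  simp

@[simp] theorem Y.lift_t {d n : ℕ} {u : ℂ} {A : Type*} [Ring A] [Algebra ℂ A] {G T : ℕ → A}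
    (h : YRep d n u G T) (i : Fin n) : Y.lift h (Y.t d u i) = T i := by
  simp only [Y.lift, Y.t, Y.mk]
  erw [RingQuot.liftAlgHom_mkAlgHom_apply]
  simp

/-- `g_i` with a total index. -/
def Y.gN (d n : ℕ) (u : ℂ) (i : ℕ) : Y d n u := if h : i < n - 1 then Y.g d u ⟨i, h⟩ else 0

/-- `t_j` with a total index. -/
def Y.tN (d n : ℕ) (u : ℂ) (j : ℕ) : Y d n u := if h : j < n then Y.t d u ⟨j, h⟩ else 0

theorem Y.mk_rel {d n : ℕ} {u : ℂ} {a b : FreeAlgebra ℂ (YGen n)} (h : YRel d n u a b) :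
    Y.mk d n u a = Y.mk d n u b := RingQuot.mkAlgHom_rel ℂ h

theorem Y.rep (d n : ℕ) (u : ℂ) : YRep d n u (Y.gN d n u) (Y.tN d n u) where
  far i j h1 h2 := by
    have := Y.mk_rel (YRel.far (d := d) (n := n) (u := u) ⟨i, by omega⟩ ⟨j, by omega⟩ h1)
    simp only [Y.gN, dif_pos (show i < n - 1 by omega), dif_pos (show j < n - 1 by omega)]
    simpa [Y.g, Y.t, lo, hi] using this
  braid i h1 := by
    have := Y.mk_rel (YRel.braid (d := d) (n := n) (u := u) ⟨i, by omega⟩ ⟨i + 1, by omega⟩ rfl)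
    simp only [Y.gN, dif_pos (show i < n - 1 by omega), dif_pos (show i + 1 < n - 1 by omega)]
    simpa [Y.g, Y.t, lo, hi] using this
  tt i j h1 h2 := by
    have := Y.mk_rel (YRel.tt (d := d) (n := n) (u := u) ⟨i, h1⟩ ⟨j, h2⟩)
    simp only [Y.tN, dif_pos h1, dif_pos h2]
    simpa [Y.g, Y.t, lo, hi] using this
  tg i j h1 h2 h3 h4 := by
    have := Y.mk_rel (YRel.tg (d := d) (n := n) (u := u) ⟨i, by omega⟩ ⟨j, h2⟩)
    rw [Equiv.swap_apply_of_ne_of_ne (by simpa [lo] using h3) (by simpa [hi] using h4)] at this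
    simp only [Y.gN, Y.tN, dif_pos (show i < n - 1 by omega), dif_pos h2]
    simpa [Y.g, Y.t, lo, hi] using this
  tg0 i h1 := by
    have := Y.mk_rel (YRel.tg (d := d) (n := n) (u := u) ⟨i, by omega⟩ (lo ⟨i, by omega⟩))
    rw [Equiv.swap_apply_left] at this
    simp only [Y.gN, Y.tN, dif_pos (show i < n - 1 by omega), dif_pos (show i < n by omega),
      dif_pos h1]
    simpa [Y.g, Y.t, lo, hi] using this
  tg1 i h1 := by
    have := Y.mk_rel (YRel.tg (d := d) (n := n) (u := u) ⟨i, by omega⟩ (hi ⟨i, by omega⟩))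
    rw [Equiv.swap_apply_right] at this
    simp only [Y.gN, Y.tN, dif_pos (show i < n - 1 by omega), dif_pos (show i < n by omega),
      dif_pos h1]
    simpa [Y.g, Y.t, lo, hi] using this
  td j h1 := by
    have := Y.mk_rel (YRel.td (d := d) (n := n) (u := u) ⟨j, h1⟩)
    simp only [Y.tN, dif_pos h1]
    simpa [Y.g, Y.t, lo, hi] using this
  quad i h1 := by
    have := Y.mk_rel (YRel.quad (d := d) (n := n) (u := u) ⟨i, by omega⟩)
    simp only [Y.gN, Y.tN, dif_pos (show i < n - 1 by omega), dif_pos (show i < n by omega),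
      dif_pos h1]
    simpa [map_idem, pow_two, Y.g, Y.t, lo, hi] using this

/- A right action of `Y_{d,n+1}(u)` on a free module of rank `n + 1`; it is used only to show
that the traces below exist. -/

section rep

variable {d n : ℕ} {u : ℂ} {A : Type*} [Ring A] [Algebra ℂ A]

/-- The standard basis of the free module of rank `n + 1`. -/
def bv (A : Type*) [Ring A] (n i : ℕ) : Fin (n + 1) →₀ A :=
  if h : i < n + 1 then Finsupp.single ⟨i, h⟩ 1 else 0

/-- The linear map with prescribed values on the standard basis. -/
def opMk (n : ℕ) (f : ℕ → (Fin (n + 1) →₀ A)) : (Fin (n + 1) →₀ A) →ₗ[A] (Fin (n + 1) →₀ A) :=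
  Finsupp.linearCombination A fun i => f i

theorem opMk_bv (f : ℕ → (Fin (n + 1) →₀ A)) (i : ℕ) (hi : i ≤ n) : opMk n f (bv A n i) = f i := by
  simp [opMk, bv, Nat.lt_succ_of_le hi]

theorem op_ext {f g : (Fin (n + 1) →₀ A) →ₗ[A] (Fin (n + 1) →₀ A)}
    (h : ∀ i ≤ n, f (bv A n i) = g (bv A n i)) : f = g := by
  refine Finsupp.lhom_ext' fun i => LinearMap.ext_ring ?_
  have := h i (Nat.le_of_lt_succ i.2)
  simp only [bv, dif_pos i.2] at this
  exact this

def opE (d : ℕ) (u : ℂ) (T : ℕ → A) (τ : A) (j : ℕ) : A := (u - 1) • idem d (T j) τ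

def opG (d n : ℕ) (u : ℂ) (G T : ℕ → A) (τ : A) (j : ℕ) :
    (Fin (n + 1) →₀ A) →ₗ[A] (Fin (n + 1) →₀ A) :=
  opMk n fun i =>
    if j + 1 < i then G j • bv A n i else if i = j + 1 then bv A n j else
    if i = j then bv A n (j + 1) + opE d u T τ j • (bv A n j + bv A n (j + 1)) else
    G (j - 1) • bv A n i

def opT (n : ℕ) (T : ℕ → A) (τ : A) (j : ℕ) :
    (Fin (n + 1) →₀ A) →ₗ[A] (Fin (n + 1) →₀ A) :=
  opMk n fun i =>
    if j < i then T j • bv A n i else if i = j then τ • bv A n i else T (j - 1) • bv A n i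

variable (G T : ℕ → A) (τ : A)

theorem opG_gt (i j : ℕ) (hi : i ≤ n) (h : j + 1 < i) :
    opG d n u G T τ j (bv A n i) = G j • bv A n i := by
  rw [opG, opMk_bv _ _ hi, if_pos h]

theorem opG_succ (j : ℕ) (hi : j + 1 ≤ n) :
    opG d n u G T τ j (bv A n (j + 1)) = bv A n j := by
  rw [opG, opMk_bv _ _ hi, if_neg (by omega), if_pos rfl]

theorem opG_self (j : ℕ) (hi : j ≤ n) :
    opG d n u G T τ j (bv A n j) =
      bv A n (j + 1) + opE d u T τ j • (bv A n j + bv A n (j + 1)) := by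
  rw [opG, opMk_bv _ _ hi, if_neg (by omega), if_neg (by omega), if_pos rfl]

theorem opG_lt (i j : ℕ) (hi : i ≤ n) (h : i < j + 1) :
    opG d n u G T τ (j + 1) (bv A n i) = G j • bv A n i := by
  rw [opG, opMk_bv _ _ hi, if_neg (by omega), if_neg (by omega), if_neg (by omega)]
  rfl

theorem opT_gt (i j : ℕ) (hi : i ≤ n) (h : j < i) :
    opT n T τ j (bv A n i) = T j • bv A n i := by
  rw [opT, opMk_bv _ _ hi, if_pos h]

theorem opT_self (j : ℕ) (hi : j ≤ n) : opT n T τ j (bv A n j) = τ • bv A n j := by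
  rw [opT, opMk_bv _ _ hi, if_neg (by omega), if_pos rfl]

theorem opT_lt (i j : ℕ) (hi : i ≤ n) (h : i < j + 1) :
    opT n T τ (j + 1) (bv A n i) = T j • bv A n i := by
  rw [opT, opMk_bv _ _ hi, if_neg (by omega), if_neg (by omega)]
  rfl

/-- The operators, multiplied in the order of a right action. -/
abbrev ROp (A : Type*) [Ring A] (n : ℕ) : Type _ := (Module.End A (Fin (n + 1) →₀ A))ᵐᵒᵖ

theorem rop_mul (f g : ROp A n) (v : Fin (n + 1) →₀ A) : (f * g).unop v = g.unop (f.unop v) := rfl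

theorem rop_pow (f : ROp A n) (a : A) (v : Fin (n + 1) →₀ A) (h : f.unop v = a • v) (k : ℕ) :
    (f ^ k).unop v = a ^ k • v := by
  induction k with
  | zero => simp
  | succ k ih => rw [pow_succ', pow_succ', rop_mul, h, map_smul, ih, smul_smul]

theorem rop_ext {f g : ROp A n} (h : ∀ i ≤ n, f.unop (bv A n i) = g.unop (bv A n i)) : f = g :=
  MulOpposite.unop_injective (op_ext h)

theorem rop_idem (f g : ROp A n) (a b : A) (v : Fin (n + 1) →₀ A) (hf : f.unop v = a • v)
    (hg : g.unop v = b • v) : (idem d f g).unop v = idem d a b • v := by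
  simp only [idem, MulOpposite.unop_smul, LinearMap.smul_apply, smul_assoc, Finset.sum_smul,
    Finset.unop_sum, LinearMap.sum_apply]
  congr 1
  refine Finset.sum_congr rfl fun s _ => ?_
  rw [rop_mul, rop_pow _ _ _ hf, map_smul, rop_pow _ _ _ hg, smul_smul]

variable {G T τ}

theorem opE_far [NeZero d] (h : YRep d n u G T) (hτ : ∀ a, τ * a = a * τ) {i j : ℕ} (hi : i < n)
    (hj : j + 1 < n) (h1 : i ≠ j) (h2 : i ≠ j + 1) :
    opE d u T τ i * G j = G j * opE d u T τ i := by
  rw [opE, smul_mul_assoc, idem_swap (h.tg j i hj hi h1 h2) (hτ _), mul_smul_comm]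

theorem opE_0 [NeZero d] (h : YRep d n u G T) (hτ : ∀ a, τ * a = a * τ) {j : ℕ}
    (hj : j + 1 < n) :
    opE d u T τ j * G j = G j * opE d u T τ (j + 1) := by
  simp only [opE, smul_mul_assoc, mul_smul_comm]
  rw [idem_swap (h.tg0 j hj) (hτ _)]

theorem opE_1 [NeZero d] (h : YRep d n u G T) (hτ : ∀ a, τ * a = a * τ) {j : ℕ}
    (hj : j + 1 < n) :
    opE d u T τ (j + 1) * G j = G j * opE d u T τ j := by
  simp only [opE, smul_mul_assoc, mul_smul_comm]
  rw [idem_swap (h.tg1 j hj) (hτ _)]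

theorem opE_T [NeZero d] (h : YRep d n u G T) (hτ : ∀ a, τ * a = a * τ) {i j : ℕ} (hi : i < n)
    (hj : j < n) :
    opE d u T τ i * T j = T j * opE d u T τ i := by
  rw [opE, smul_mul_assoc, idem_swap (h.tt i j hi hj) (hτ _), mul_smul_comm]

theorem opE_E [NeZero d] (h : YRep d n u G T) (hτ : ∀ a, τ * a = a * τ) {i j : ℕ} (hi : i < n)
    (hj : j < n) :
    opE d u T τ i * opE d u T τ j = opE d u T τ j * opE d u T τ i := by
  conv_lhs => rw [opE]
  rw [smul_mul_assoc, idem_swap (a' := T i) (b' := τ) (opE_T h hτ hj hi).symm (hτ _),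
    ← mul_smul_comm]
  rfl

theorem opE_EE [NeZero d] (h : YRep d n u G T) (hτ : ∀ a, τ * a = a * τ) (hd : τ ^ d = 1) {j : ℕ}
    (hj : j + 1 < n) :
    opE d u T τ j * opE d u T τ (j + 1) =
      opE d u T τ (j + 1) * ((u - 1) • idem d (T j) (T (j + 1))) := by
  simp only [opE, smul_mul_assoc, mul_smul_comm]
  rw [idem_mul (h.td _ hj) hd (h.tt _ _ (by omega) hj) (hτ _).symm (hτ _).symm]

theorem opGGG [NeZero d] (h : YRep d n u G T) (hτ : ∀ a, τ * a = a * τ) (hd : τ ^ d = 1) {j : ℕ}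
    (hj : j + 1 < n) :
    G j * opE d u T τ j * G j = opE d u T τ (j + 1) +
      opE d u T τ j * opE d u T τ (j + 1) + opE d u T τ j * opE d u T τ (j + 1) * G j := by
  rw [← opE_1 h hτ hj, mul_assoc, h.quad j hj, opE_EE h hτ hd hj]
  simp only [mul_add, mul_one, smul_mul_assoc, mul_smul_comm, mul_assoc]

theorem rop_rep [NeZero d] (h : YRep d n u G T) (hτ : ∀ a, τ * a = a * τ) (hd : τ ^ d = 1) :
    YRep d (n + 1) u (A := ROp A n) (fun j => MulOpposite.op (opG d n u G T τ j))
      (fun j => MulOpposite.op (opT n T τ j)) where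
  far i j h1 h2 := by
    refine rop_ext fun k hk => ?_
    simp only [rop_mul, MulOpposite.unop_op]
    obtain ⟨j, rfl⟩ : ∃ j', j = j' + 1 := ⟨j - 1, by omega⟩
    rcases lt_trichotomy k (j + 1) with hkj | rfl | hkj
    · have ej := opG_lt (d := d) (u := u) (n := n) G T τ k j hk (by omega)
      rcases lt_trichotomy k (i + 1) with hki | rfl | hki
      · rcases Nat.lt_succ_iff_lt_or_eq.1 hki with hki | rfl
        · obtain ⟨i, rfl⟩ : ∃ j', i = j' + 1 := ⟨i - 1, by omega⟩
          have ei := opG_lt (d := d) (u := u) (n := n) G T τ k i hk (by omega)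
          rw [ej, ei, map_smul, map_smul, ej, ei, smul_smul, smul_smul, h.far i j (by omega)
            (by omega)]
        · rw [ej, opG_self _ _ _ _ (by omega), map_smul, opG_self _ _ _ _ (by omega)]
          simp only [map_add, map_smul]
          rw [ej, opG_lt _ _ _ _ _ (by omega) (by omega)]
          simp only [smul_add, smul_smul]
          rw [opE_far h hτ (i := k) (j := j) (by omega) (by omega) (by omega) (by omega)]
      · rw [ej, opG_succ _ _ _ _ (by omega), map_smul, opG_succ _ _ _ _ (by omega),
          opG_lt _ _ _ _ _ (by omega) (by omega)]
      · have ei := opG_gt (d := d) (u := u) (n := n) G T τ k i hk (by omega)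
        rw [ej, ei, map_smul, map_smul, ej, ei, smul_smul, smul_smul, h.far i j (by omega)
            (by omega)]
    · have ei := opG_gt (d := d) (u := u) (n := n) G T τ (j + 1) i hk (by omega)
      rw [ei, map_smul, opG_self _ _ _ _ (by omega)]
      simp only [map_add, map_smul, smul_add, smul_smul]
      rw [ei, opG_gt _ _ _ _ _ (by omega) (by omega)]
      simp only [smul_smul]
      rw [opE_far h hτ (i := j + 1) (j := i) (by omega) (by omega) (by omega) (by omega)]
    · have ei := opG_gt (d := d) (u := u) (n := n) G T τ k i hk (by omega)
      rcases Nat.lt_or_ge (j + 2) k with hk2 | hk2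
      · have ej := opG_gt (d := d) (u := u) (n := n) G T τ k (j + 1) hk (by omega)
        rw [ej, ei, map_smul, map_smul, ej, ei, smul_smul, smul_smul, h.far i (j + 1) (by omega)
            (by omega)]
      · obtain rfl : k = j + 2 := by omega
        rw [ei, map_smul, opG_succ _ _ _ _ (by omega), opG_gt _ _ _ _ _ (by omega) (by omega)]
  braid i h1 := by
    refine rop_ext fun k hk => ?_
    simp only [rop_mul, MulOpposite.unop_op]
    rcases Nat.lt_or_ge k i with hki | hki
    · obtain ⟨i, rfl⟩ : ∃ j', i = j' + 1 := ⟨i - 1, by omega⟩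
      have e1 := opG_lt (d := d) (u := u) (n := n) G T τ k i hk (by omega)
      have e2 := opG_lt (d := d) (u := u) (n := n) G T τ k (i + 1) hk (by omega)
      simp only [e1, e2, map_smul, smul_smul]
      rw [h.braid i (by omega)]
    rcases Nat.lt_or_ge (i + 2) k with hki2 | hki2
    · have e1 := opG_gt (d := d) (u := u) (n := n) G T τ k i hk (by omega)
      have e2 := opG_gt (d := d) (u := u) (n := n) G T τ k (i + 1) hk (by omega)
      simp only [e1, e2, map_smul, smul_smul]
      rw [h.braid i (by omega)]
    have a0 := opG_self (d := d) (u := u) (n := n) G T τ i (by omega)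
    have a1 := opG_succ (d := d) (u := u) (n := n) G T τ i (by omega)
    have a2 := opG_gt (d := d) (u := u) (n := n) G T τ (i + 2) i (by omega) (by omega)
    have b0 := opG_lt (d := d) (u := u) (n := n) G T τ i i (by omega) (by omega)
    have b1 := opG_self (d := d) (u := u) (n := n) G T τ (i + 1) (by omega)
    have b2 := opG_succ (d := d) (u := u) (n := n) G T τ (i + 1) (by omega)
    have c0 := opE_0 (u := u) h hτ (j := i) (by omega)
    have c1 := opE_1 (u := u) h hτ (j := i) (by omega)
    have c2 := opE_E (u := u) h hτ (i := i) (j := i + 1) (by omega) (by omega)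
    have c3 := opGGG (u := u) h hτ hd (j := i) (by omega)
    rw [add_assoc] at b1 b2
    norm_num only at b1 b2
    obtain rfl | rfl | rfl : k = i ∨ k = i + 1 ∨ k = i + 2 := by omega
    · simp only [a0, a1, a2, b0, b1, b2, map_add, map_smul, smul_add, smul_smul, c0]
      set E := opE d u T τ k
      set E' := opE d u T τ (k + 1)
      have d1 : E * G k * E = E * E' * G k := by rw [mul_assoc, ← c1, mul_assoc]
      have d2 : G k * E * E' = G k * E' * E := by rw [mul_assoc, c2, mul_assoc]
      have d3 : E * E' * G k = G k * E' * E := by rw [mul_assoc, c1, ← mul_assoc, c0]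
      have d4 : E' * G k = G k * E := c1
      rw [c3]
      simp only [add_smul, d1, d2, d3, d4]
      abel
    · simp only [a0, a1, a2, b0, b1, b2, map_add, map_smul, smul_add, smul_smul, c1]
    · simp only [a0, a1, a2, b0, b1, b2, map_add, map_smul, smul_add, smul_smul]
  tt i j h1 h2 := by
    have key : ∀ i k, i < n + 1 → k ≤ n → ∃ a, opT n T τ i (bv A n k) = a • bv A n k ∧
        (a = τ ∨ ∃ l < n, a = T l) := by
      intro i k hi hk
      rcases lt_trichotomy i k with hik | rfl | hik
      · exact ⟨_, opT_gt _ _ _ _ hk hik, Or.inr ⟨i, by omega, rfl⟩⟩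
      · exact ⟨_, opT_self _ _ _ hk, Or.inl rfl⟩
      · obtain ⟨i, rfl⟩ : ∃ j', i = j' + 1 := ⟨i - 1, by omega⟩
        exact ⟨_, opT_lt _ _ _ _ hk hik, Or.inr ⟨i, by omega, rfl⟩⟩
    refine rop_ext fun k hk => ?_
    simp only [rop_mul, MulOpposite.unop_op]
    obtain ⟨a, ha, ha'⟩ := key i k h1 hk
    obtain ⟨b, hb, hb'⟩ := key j k h2 hk
    rw [ha, hb, map_smul, map_smul, ha, hb, smul_smul, smul_smul]
    congr 1
    rcases ha' with rfl | ⟨l, hl, rfl⟩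
    · exact hτ _
    rcases hb' with rfl | ⟨l', hl', rfl⟩
    · exact (hτ _).symm
    exact h.tt _ _ hl hl'
  tg i j h1 h2 h3 h4 := by
    refine rop_ext fun k hk => ?_
    simp only [rop_mul, MulOpposite.unop_op]
    rcases Nat.lt_or_ge (i + 1) k with hki | hki
    · have e1 := opG_gt (d := d) (u := u) (n := n) G T τ k i hk (by omega)
      rcases lt_trichotomy j k with hjk | rfl | hjk
      · have e2 := opT_gt (n := n) T τ k j hk (by omega)
        simp only [e1, e2, map_smul, smul_smul]
        rw [h.tg i j (by omega) (by omega) h3 h4]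
      · have e2 := opT_self (n := n) T τ j hk
        simp only [e1, e2, map_smul, smul_smul, hτ]
      · obtain ⟨j, rfl⟩ : ∃ j', j = j' + 1 := ⟨j - 1, by omega⟩
        have e2 := opT_lt (n := n) T τ k j hk (by omega)
        simp only [e1, e2, map_smul, smul_smul]
        rw [h.tg i j (by omega) (by omega) (by omega) (by omega)]
    rcases Nat.lt_or_ge k i with hki' | hki'
    · obtain ⟨i, rfl⟩ : ∃ j', i = j' + 1 := ⟨i - 1, by omega⟩
      have e1 := opG_lt (d := d) (u := u) (n := n) G T τ k i hk (by omega)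
      rcases lt_trichotomy j k with hjk | rfl | hjk
      · have e2 := opT_gt (n := n) T τ k j hk (by omega)
        simp only [e1, e2, map_smul, smul_smul]
        rw [h.tg i j (by omega) (by omega) (by omega) (by omega)]
      · have e2 := opT_self (n := n) T τ j hk
        simp only [e1, e2, map_smul, smul_smul, hτ]
      · obtain ⟨j, rfl⟩ : ∃ j', j = j' + 1 := ⟨j - 1, by omega⟩
        have e2 := opT_lt (n := n) T τ k j hk (by omega)
        simp only [e1, e2, map_smul, smul_smul]
        rw [h.tg i j (by omega) (by omega) (by omega) (by omega)]
    have a0 := opG_self (d := d) (u := u) (n := n) G T τ i (by omega)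
    have a1 := opG_succ (d := d) (u := u) (n := n) G T τ i (by omega)
    obtain ⟨l, hl, hl0, hl1⟩ : ∃ l < n, opT n T τ j (bv A n i) = T l • bv A n i ∧
        opT n T τ j (bv A n (i + 1)) = T l • bv A n (i + 1) := by
      rcases Nat.lt_or_ge j i with hji | hji
      · exact ⟨j, by omega, opT_gt _ _ _ _ (by omega) (by omega),
          opT_gt _ _ _ _ (by omega) (by omega)⟩
      · obtain ⟨j, rfl⟩ : ∃ j', j = j' + 1 := ⟨j - 1, by omega⟩
        exact ⟨j, by omega, opT_lt _ _ _ _ (by omega) (by omega),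
          opT_lt _ _ _ _ (by omega) (by omega)⟩
    obtain rfl | rfl : k = i ∨ k = i + 1 := by omega
    · simp only [a0, hl0, hl1, map_add, map_smul, smul_add, smul_smul]
      rw [opE_T h hτ (by omega) hl]
    · simp only [a1, hl0, hl1, map_add, map_smul, smul_add, smul_smul]
  tg0 i h1 := by
    refine rop_ext fun k hk => ?_
    simp only [rop_mul, MulOpposite.unop_op]
    rcases Nat.lt_or_ge (i + 1) k with hki | hki
    · have e1 := opG_gt (d := d) (u := u) (n := n) G T τ k i hk (by omega)
      have e2 := opT_gt (n := n) T τ k i hk (by omega)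
      have e3 := opT_gt (n := n) T τ k (i + 1) hk (by omega)
      simp only [e1, e2, e3, map_smul, smul_smul]
      rw [h.tg0 i (by omega)]
    rcases Nat.lt_or_ge k i with hki' | hki'
    · obtain ⟨i, rfl⟩ : ∃ j', i = j' + 1 := ⟨i - 1, by omega⟩
      have e1 := opG_lt (d := d) (u := u) (n := n) G T τ k i hk (by omega)
      have e2 := opT_lt (n := n) T τ k i hk (by omega)
      have e3 := opT_lt (n := n) T τ k (i + 1) hk (by omega)
      simp only [e1, e2, e3, map_smul, smul_smul]
      rw [h.tg0 i (by omega)]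
    have a0 := opG_self (d := d) (u := u) (n := n) G T τ i (by omega)
    have a1 := opG_succ (d := d) (u := u) (n := n) G T τ i (by omega)
    have b0 := opT_self (n := n) T τ i (by omega)
    have b1 := opT_gt (n := n) T τ (i + 1) i (by omega) (by omega)
    have c0 := opT_lt (n := n) T τ i i (by omega) (by omega)
    have c1 := opT_self (n := n) T τ (i + 1) (by omega)
    obtain rfl | rfl : k = i ∨ k = i + 1 := by omega
    · simp only [a0, a1, b0, b1, c0, c1, map_add, map_smul, smul_add, smul_smul]
      have : opE d u T τ k * T k = opE d u T τ k * τ := by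
        simp only [opE, smul_mul_assoc]
        rw [idem_mul_self (h.td k (by omega)) hd (hτ _).symm]
      rw [hτ, this]
    · simp only [a0, a1, b0, b1, c0, c1, map_add, map_smul, smul_add, smul_smul]
  tg1 i h1 := by
    refine rop_ext fun k hk => ?_
    simp only [rop_mul, MulOpposite.unop_op]
    rcases Nat.lt_or_ge (i + 1) k with hki | hki
    · have e1 := opG_gt (d := d) (u := u) (n := n) G T τ k i hk (by omega)
      have e2 := opT_gt (n := n) T τ k i hk (by omega)
      have e3 := opT_gt (n := n) T τ k (i + 1) hk (by omega)
      simp only [e1, e2, e3, map_smul, smul_smul]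
      rw [h.tg1 i (by omega)]
    rcases Nat.lt_or_ge k i with hki' | hki'
    · obtain ⟨i, rfl⟩ : ∃ j', i = j' + 1 := ⟨i - 1, by omega⟩
      have e1 := opG_lt (d := d) (u := u) (n := n) G T τ k i hk (by omega)
      have e2 := opT_lt (n := n) T τ k i hk (by omega)
      have e3 := opT_lt (n := n) T τ k (i + 1) hk (by omega)
      simp only [e1, e2, e3, map_smul, smul_smul]
      rw [h.tg1 i (by omega)]
    have a0 := opG_self (d := d) (u := u) (n := n) G T τ i (by omega)
    have a1 := opG_succ (d := d) (u := u) (n := n) G T τ i (by omega)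
    have b0 := opT_self (n := n) T τ i (by omega)
    have b1 := opT_gt (n := n) T τ (i + 1) i (by omega) (by omega)
    have c0 := opT_lt (n := n) T τ i i (by omega) (by omega)
    have c1 := opT_self (n := n) T τ (i + 1) (by omega)
    obtain rfl | rfl : k = i ∨ k = i + 1 := by omega
    · simp only [a0, a1, b0, b1, c0, c1, map_add, map_smul, smul_add, smul_smul]
      have : opE d u T τ k * T k = opE d u T τ k * τ := by
        simp only [opE, smul_mul_assoc]
        rw [idem_mul_self (h.td k (by omega)) hd (hτ _).symm]
      rw [← opE_T h hτ (by omega) (by omega), this]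
    · simp only [a0, a1, b0, b1, c0, c1, map_add, map_smul, smul_add, smul_smul]
  td j hj := by
    refine rop_ext fun k hk => ?_
    rcases lt_trichotomy j k with hjk | rfl | hjk
    · rw [rop_pow (MulOpposite.op (opT n T τ _)) (T j) _ (opT_gt _ _ _ _ hk hjk), h.td j (by omega)]; simp
    · rw [rop_pow (MulOpposite.op (opT n T τ _)) τ _ (opT_self _ _ _ hk), hd]; simp
    · obtain ⟨j, rfl⟩ : ∃ j', j = j' + 1 := ⟨j - 1, by omega⟩
      rw [rop_pow (MulOpposite.op (opT n T τ _)) (T j) _ (opT_lt _ _ _ _ hk hjk), h.td j (by omega)]; simp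
  quad j hj := by
    refine rop_ext fun k hk => ?_
    simp only [rop_mul, MulOpposite.unop_op, MulOpposite.unop_add, MulOpposite.unop_smul,
      LinearMap.add_apply, LinearMap.smul_apply, MulOpposite.unop_one, Module.End.one_apply]
    rcases Nat.lt_or_ge (j + 1) k with hkj | hkj
    · have e1 := opG_gt (d := d) (u := u) (n := n) G T τ k j hk (by omega)
      rw [rop_idem (MulOpposite.op (opT n T τ _)) (MulOpposite.op (opT n T τ _)) (T j) (T (j + 1)) _ (opT_gt _ _ _ _ hk (by omega))
        (opT_gt _ _ _ _ hk (by omega))]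
      simp only [e1, map_smul, smul_smul, h.quad j (by omega), add_smul, smul_assoc, one_smul]
    rcases Nat.lt_or_ge k j with hkj' | hkj'
    · obtain ⟨j, rfl⟩ : ∃ j', j = j' + 1 := ⟨j - 1, by omega⟩
      have e1 := opG_lt (d := d) (u := u) (n := n) G T τ k j hk (by omega)
      rw [rop_idem (MulOpposite.op (opT n T τ _)) (MulOpposite.op (opT n T τ _)) (T j) (T (j + 1)) _ (opT_lt _ _ _ _ hk (by omega))
        (opT_lt _ _ _ _ hk (by omega))]
      simp only [e1, map_smul, smul_smul, h.quad j (by omega), add_smul, smul_assoc, one_smul]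
    have a0 := opG_self (d := d) (u := u) (n := n) G T τ j (by omega)
    have a1 := opG_succ (d := d) (u := u) (n := n) G T τ j (by omega)
    obtain rfl | rfl : k = j ∨ k = j + 1 := by omega
    · rw [rop_idem (MulOpposite.op (opT n T τ _)) (MulOpposite.op (opT n T τ _)) τ (T k) _ (opT_self _ _ _ hk) (opT_lt _ _ _ _ hk (by omega)),
        idem_comm hd (h.td _ (by omega)) (hτ _)]
      simp only [a0, a1, map_add, map_smul, smul_add, ← smul_assoc]
      simp only [smul_smul, ← opE.eq_1]
      abel
    · rw [rop_idem (MulOpposite.op (opT n T τ _)) (MulOpposite.op (opT n T τ _)) (T j) τ _ (opT_gt _ _ _ _ hk (by omega)) (opT_self _ _ _ hk)]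
      simp only [a0, a1, map_add, map_smul, smul_add, ← smul_assoc]
      simp only [← opE.eq_1]
      abel

end rep

/- The tower of subalgebras generated by the generators on the first `m` strands; it is used only
to show that the traces below exist. -/

section tower

variable {d N : ℕ} {u : ℂ} {A : Type*} [Ring A] [Algebra ℂ A] {G T : ℕ → A}

/-- The subalgebra generated by the generators on the first `m` strands. -/
def Sub (G T : ℕ → A) (m : ℕ) : Subalgebra ℂ A :=
  Algebra.adjoin ℂ ({y | ∃ i, i + 1 < m ∧ y = G i} ∪ {y | ∃ j, j < m ∧ y = T j})

theorem G_mem {i m : ℕ} (h : i + 1 < m) : G i ∈ Sub G T m :=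
  Algebra.subset_adjoin (Or.inl ⟨i, h, rfl⟩)

theorem T_mem {j m : ℕ} (h : j < m) : T j ∈ Sub G T m :=
  Algebra.subset_adjoin (Or.inr ⟨j, h, rfl⟩)

theorem pz_mem {j m : ℕ} (h : j < m) (k : ZMod d) : pz (T j) k ∈ Sub G T m :=
  pow_mem (T_mem h) _

theorem Sub_mono {m m' : ℕ} (h : m ≤ m') : Sub G T m ≤ Sub G T m' := by
  refine Algebra.adjoin_le ?_
  rintro y (⟨i, hi, rfl⟩ | ⟨j, hj, rfl⟩)
  · exact G_mem (by omega)
  · exact T_mem (by omega)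

theorem Sub_commute {m : ℕ} {y c : A} (hG : ∀ i, i + 1 < m → G i * y = y * G i)
    (hT : ∀ j, j < m → T j * y = y * T j) (hc : c ∈ Sub G T m) : c * y = y * c := by
  have : Sub G T m ≤ Subalgebra.centralizer ℂ {y} := by
    refine Algebra.adjoin_le ?_
    rintro _ (⟨i, hi, rfl⟩ | ⟨j, hj, rfl⟩) z hz
    · rw [Set.mem_singleton_iff.1 hz]; exact (hG i hi).symm
    · rw [Set.mem_singleton_iff.1 hz]; exact (hT j hj).symm
  exact ((this hc) y rfl).symm

theorem Sub_comm_G (h : YRep d N u G T) {m j : ℕ} {c : A} (hc : c ∈ Sub G T m) (hm : m ≤ j)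
    (hj : j + 1 < N) : c * G j = G j * c :=
  Sub_commute (fun i hi => h.far i j (by omega) hj)
    (fun i hi => h.tg j i hj (by omega) (by omega) (by omega)) hc

theorem Sub_comm_T (h : YRep d N u G T) {m j : ℕ} {c : A} (hc : c ∈ Sub G T m) (hm : m ≤ j)
    (hj : j < N) : c * T j = T j * c :=
  Sub_commute (fun i hi => (h.tg i j (by omega) hj (by omega) (by omega)).symm)
    (fun i hi => h.tt i j (by omega) hj) hc

theorem Sub_comm_pz (h : YRep d N u G T) {m j : ℕ} {c : A} (hc : c ∈ Sub G T m) (hm : m ≤ j)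
    (hj : j < N) (k : ZMod d) : c * pz (T j) k = pz (T j) k * c :=
  (pz_swap (Sub_comm_T h hc hm hj).symm k).symm

/-- The word `G_{i+r-1} ⋯ G_{i+1} G_i`. -/
def W (G : ℕ → A) : ℕ → ℕ → A
  | _, 0 => 1
  | i, r + 1 => W G (i + 1) r * G i

theorem W_top (i r : ℕ) : W G i (r + 1) = G (i + r) * W G i r := by
  induction r generalizing i with
  | zero => simp [W]
  | succ r ih =>
    rw [W, ih, W, ← mul_assoc]
    congr 3
    omega

theorem W_mem (i r m : ℕ) (h : i + r < m) : W G i r ∈ Sub G T m := by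
  induction r with
  | zero => exact one_mem _
  | succ r ih => rw [W_top]; exact mul_mem (G_mem (by omega)) (ih (by omega))

theorem W_comm {y : A} {i r : ℕ} (h : ∀ j, i ≤ j → j < i + r → G j * y = y * G j) :
    W G i r * y = y * W G i r := by
  induction r with
  | zero => simp [W]
  | succ r ih =>
    rw [W_top, mul_assoc, ih (fun j h1 h2 => h j h1 (by omega)), ← mul_assoc,
      h _ (by omega) (by omega), mul_assoc]

theorem W_G_lt (h : YRep d N u G T) {i r j : ℕ} (hj : j + 1 < i) (hN : i + r < N) :
    W G i r * G j = G j * W G i r :=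
  W_comm fun _ h1 _ => (h.far _ _ (by omega) (by omega)).symm

theorem W_T_lt (h : YRep d N u G T) {i r j : ℕ} (hj : j < i) (hN : i + r < N) :
    W G i r * T j = T j * W G i r :=
  W_comm fun _ h1 _ => (h.tg _ _ (by omega) (by omega) (by omega) (by omega)).symm

theorem W_G_gt (h : YRep d N u G T) {i r j : ℕ} (hj : i ≤ j) (hj' : j + 1 < i + r)
    (hN : i + r < N) : W G i r * G (j + 1) = G j * W G i r := by
  induction r generalizing i with
  | zero => omega
  | succ r ih =>
    rcases hj.eq_or_lt with rfl | hlt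
    · obtain ⟨r, rfl⟩ : ∃ r', r = r' + 1 := ⟨r - 1, by omega⟩
      rw [W, W, mul_assoc, mul_assoc, ← mul_assoc (G (i + 1)), ← h.braid i (by omega),
        mul_assoc, ← mul_assoc, W_G_lt h (by omega) (by omega)]
      simp only [mul_assoc]
    · rw [W, mul_assoc, h.far i (j + 1) (by omega) (by omega), ← mul_assoc,
        ih (by omega) (by omega) (by omega), mul_assoc]

theorem W_T_gt (h : YRep d N u G T) {i r j : ℕ} (hj : i ≤ j) (hj' : j < i + r)
    (hN : i + r < N) : W G i r * T (j + 1) = T j * W G i r := by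
  induction r generalizing i with
  | zero => omega
  | succ r ih =>
    rcases hj.eq_or_lt with rfl | hlt
    · rw [W, mul_assoc, ← h.tg0 i (by omega), ← mul_assoc, W_T_lt h (by omega) (by omega),
        mul_assoc]
    · rw [W, mul_assoc, ← h.tg i (j + 1) (by omega) (by omega) (by omega) (by omega), ← mul_assoc,
        ih (by omega) (by omega) (by omega), mul_assoc]

/-- The span of the inductive basis. -/
def Bspan (d : ℕ) (G T : ℕ → A) (m : ℕ) : Submodule ℂ A :=
  Submodule.span ℂ {y | ∃ a ∈ Sub G T m, ∃ i r, ∃ k : ZMod d, i + r = m ∧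
    y = a * W G i r * pz (T i) k}

theorem Bspan_base {a : A} {m i r : ℕ} (ha : a ∈ Sub G T m) (k : ZMod d) (h : i + r = m) :
    a * W G i r * pz (T i) k ∈ Bspan d G T m :=
  Submodule.subset_span ⟨a, ha, i, r, k, h, rfl⟩

theorem Bspan_mul_T [NeZero d] (h : YRep d N u G T) {m j : ℕ} (hm : m < N) (hj : j ≤ m) {a : A}
    (ha : a ∈ Sub G T m) {i r : ℕ} (k : ZMod d) (hir : i + r = m) :
    a * W G i r * pz (T i) k * T j ∈ Bspan d G T m := by
  rw [mul_assoc, pz_swap (h.tt i j (by omega) (by omega)), ← mul_assoc, mul_assoc a]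
  rcases lt_trichotomy j i with hji | rfl | hji
  · rw [W_T_lt h hji (by omega), ← mul_assoc]
    exact Bspan_base (mul_mem ha (T_mem (by omega))) k hir
  · have h1 : pz (T j) (1 : ZMod d) = T j := by
      simpa using pz_natCast (h.td j (by omega)) 1
    rw [← mul_assoc, mul_assoc _ (T j)]
    conv => enter [2, 2, 1]; rw [← h1]
    rw [← pz_add (h.td j (by omega))]
    exact Bspan_base ha _ hir
  · obtain ⟨j, rfl⟩ : ∃ j', j = j' + 1 := ⟨j - 1, by omega⟩
    rw [W_T_gt h (by omega) (by omega) (by omega), ← mul_assoc]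
    exact Bspan_base (mul_mem ha (T_mem (by omega))) k hir

theorem Bspan_mul_G [NeZero d] (h : YRep d N u G T) {m j : ℕ} (hm : m < N) (hj : j < m) {a : A}
    (ha : a ∈ Sub G T m) {i r : ℕ} (k : ZMod d) (hir : i + r = m) :
    a * W G i r * pz (T i) k * G j ∈ Bspan d G T m := by
  rcases lt_trichotomy i j with hji | rfl | hji
  · obtain ⟨j, rfl⟩ : ∃ j', j = j' + 1 := ⟨j - 1, by omega⟩
    rw [mul_assoc, pz_swap (h.tg _ _ (by omega) (by omega) (by omega) (by omega)), ← mul_assoc,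
      mul_assoc a, W_G_gt h (by omega) (by omega) (by omega), ← mul_assoc]
    exact Bspan_base (mul_mem ha (G_mem (by omega))) k hir
  · obtain ⟨r, rfl⟩ : ∃ r', r = r' + 1 := ⟨r - 1, by omega⟩
    have hi : i + 1 < N := by omega
    have hc := W_T_lt h (i := i + 1) (r := r) (j := i) (by omega) (by omega)
    have hc' : ∀ s : ZMod d, W G (i + 1) r * pz (T i) s = pz (T i) s * W G (i + 1) r :=
      fun s => (pz_swap hc.symm s).symm
    have hTT : ∀ s s' : ZMod d, pz (T i) s * pz (T (i + 1)) s' = pz (T (i + 1)) s' * pz (T i) s :=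
      fun s s' => Commute.pow_pow (h.tt i (i + 1) (by omega) hi) _ _
    have e0 : a * W G i (r + 1) * pz (T i) k * G i =
        a * W G (i + 1) r * pz (T (i + 1)) k +
        (u - 1) • (a * W G (i + 1) r * idem d (T i) (T (i + 1)) * pz (T (i + 1)) k) +
        (u - 1) • (a * W G (i + 1) r * idem d (T i) (T (i + 1)) * pz (T i) k * G i) := by
      rw [mul_assoc, pz_swap (h.tg0 i hi), W]
      have : a * (W G (i + 1) r * G i) * (G i * pz (T (i + 1)) k) =
        a * W G (i + 1) r * (G i * G i) * pz (T (i + 1)) k := by simp only [mul_assoc]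
      rw [this, h.quad i hi]
      simp only [mul_add, add_mul, mul_one, mul_smul_comm, smul_mul_assoc]
      congr 2
      simp only [mul_assoc]
      rw [pz_swap (h.tg0 i hi)]
    rw [e0]
    refine add_mem (add_mem (Bspan_base ha k (by omega)) (Submodule.smul_mem _ _ ?_))
      (Submodule.smul_mem _ _ ?_)
    · rw [idem_eq (h.td _ hi)]
      simp only [mul_smul_comm, smul_mul_assoc, Finset.mul_sum, Finset.sum_mul]
      refine Submodule.smul_mem _ _ (Submodule.sum_mem _ fun s _ => ?_)
      have : a * W G (i + 1) r * (pz (T i) s * pz (T (i + 1)) (-s)) * pz (T (i + 1)) k =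
          a * pz (T i) s * W G (i + 1) r * pz (T (i + 1)) (-s + k) := by
        rw [pz_add (h.td _ hi), mul_assoc a (pz (T i) s), ← hc']
        simp only [mul_assoc]
      rw [this]
      exact Bspan_base (mul_mem ha (pz_mem (by omega) _)) _ (by omega)
    · rw [idem_eq (h.td _ hi)]
      simp only [mul_smul_comm, smul_mul_assoc, Finset.mul_sum, Finset.sum_mul]
      refine Submodule.smul_mem _ _ (Submodule.sum_mem _ fun s _ => ?_)
      have : a * W G (i + 1) r * (pz (T i) s * pz (T (i + 1)) (-s)) * pz (T i) k * G i =
          a * pz (T i) (s + k) * W G i (r + 1) * pz (T i) (-s) := by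
        have e1 := pz_swap (h.tg1 i hi) (-s)
        rw [pz_add (h.td _ (by omega)), W]
        calc _ = a * W G (i + 1) r * (pz (T i) s * (pz (T (i + 1)) (-s) * pz (T i) k) * G i) := by
              simp only [mul_assoc]
          _ = a * (W G (i + 1) r * (pz (T i) s * pz (T i) k)) * (pz (T (i + 1)) (-s) * G i) := by
              rw [← hTT]; simp only [mul_assoc]
          _ = _ := by
              rw [e1, ← mul_assoc (W G (i + 1) r), hc', mul_assoc (pz (T i) s), hc']
              simp only [mul_assoc]
      rw [this]
      exact Bspan_base (mul_mem ha (pz_mem (by omega) _)) _ (by omega)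
  · rcases Nat.lt_or_ge (j + 1) i with hji' | hji'
    · rw [mul_assoc, pz_swap (h.tg _ _ (by omega) (by omega) (by omega) (by omega)), ← mul_assoc,
        mul_assoc a, W_G_lt h (by omega) (by omega), ← mul_assoc]
      exact Bspan_base (mul_mem ha (G_mem (by omega))) k hir
    · obtain rfl : i = j + 1 := by omega
      rw [mul_assoc, pz_swap (h.tg1 _ (by omega)), ← mul_assoc, mul_assoc a,
        show W G (j + 1) r * G j = W G j (r + 1) from rfl]
      exact Bspan_base ha k (by omega)

theorem Sub_le_Bspan [NeZero d] (h : YRep d N u G T) {m : ℕ} (hm : m < N) {y : A}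
    (hy : y ∈ Sub G T (m + 1)) : y ∈ Bspan d G T m := by
  have key : ∀ s ∈ Bspan d G T m, s * y ∈ Bspan d G T m := by
    induction hy using Algebra.adjoin_induction with
    | mem x hx =>
      intro s hs
      induction hs using Submodule.span_induction with
      | mem s hs =>
        obtain ⟨a, ha, i, r, k, hir, rfl⟩ := hs
        rcases hx with ⟨j, hj, rfl⟩ | ⟨j, hj, rfl⟩
        · exact Bspan_mul_G h hm (by omega) ha k hir
        · exact Bspan_mul_T h hm (by omega) ha k hir
      | zero => simp
      | add s t _ _ h1 h2 => rw [add_mul]; exact add_mem h1 h2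
      | smul c s _ h1 => rw [smul_mul_assoc]; exact Submodule.smul_mem _ _ h1
    | algebraMap c =>
      intro s hs
      rw [← Algebra.commutes, ← Algebra.smul_def]
      exact Submodule.smul_mem _ _ hs
    | add y z _ _ h1 h2 => intro s hs; rw [mul_add]; exact add_mem (h1 s hs) (h2 s hs)
    | mul y z _ _ h1 h2 => intro s hs; rw [← mul_assoc]; exact h2 _ (h1 s hs)
  have h1 : (1 : A) ∈ Bspan d G T m := by
    simpa [W] using Bspan_base (d := d) (one_mem (Sub G T m)) 0 (add_zero m)
  simpa using key 1 h1

theorem Sub_induct [NeZero d] (h : YRep d N u G T) {m : ℕ} (hm : m < N) {P : A → Prop}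
    (h0 : P 0) (hadd : ∀ x y, P x → P y → P (x + y)) (hsmul : ∀ (c : ℂ) x, P x → P (c • x))
    (hT : ∀ a ∈ Sub G T m, ∀ k : ZMod d, P (a * pz (T m) k))
    (hG : ∀ l, m = l + 1 → ∀ a ∈ Sub G T (l + 1), ∀ b ∈ Sub G T (l + 1), P (a * G l * b))
    {y : A} (hy : y ∈ Sub G T (m + 1)) : P y := by
  have := Sub_le_Bspan h hm hy
  clear hy
  induction this using Submodule.span_induction with
  | mem y hy' =>
    obtain ⟨a, ha, i, r, k, hir, rfl⟩ := hy'
    rcases r with _ | r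
    · obtain rfl : i = m := by omega
      simpa [W] using hT a ha k
    · rw [W_top, ← mul_assoc, mul_assoc]
      obtain rfl : m = i + r + 1 := by omega
      exact hG _ rfl a ha _ (mul_mem (W_mem _ _ _ (by omega)) (pz_mem (by omega) _))
  | zero => exact h0
  | add x y _ _ h1 h2 =>
    exact hadd x y h1 h2
  | smul c x _ h1 => exact hsmul c x h1

end tower

/- A functional that obeys the Markov and framing rules, and is a trace on `n` strands, is a trace
on `n + 1` strands. -/

section tracial

variable {d N : ℕ} [NeZero d] {u : ℂ} {A : Type*} [Ring A] [Algebra ℂ A] {G T : ℕ → A}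
  {R : Type*} [CommRing R] [Algebra ℂ R]

/-- The Markov and framing rules for a functional on the algebra of `N` strands. -/
structure Rules (N : ℕ) (G T : ℕ → A) (z : R) (x : ZMod d → R) (Φ : A →ₗ[ℂ] R) : Prop where
  r1 : ∀ m, m + 1 < N → ∀ a ∈ Sub G T (m + 1), ∀ b ∈ Sub G T (m + 1),
    Φ (a * G m * b) = z * Φ (a * b)
  r2 : ∀ m, m < N → ∀ a ∈ Sub G T m, ∀ k : ZMod d, Φ (a * pz (T m) k) = x k * Φ a

variable {z : R} {x : ZMod d → R} {Φ : A →ₗ[ℂ] R}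

theorem E1 (h : YRep d N u G T) (H : Rules N G T z x Φ) {m : ℕ} (hm : m + 1 < N) {y : A}
    (hy : y ∈ Sub G T (m + 1)) (k : ZMod d) :
    Φ (y * idem d (T m) (T (m + 1)) * pz (T (m + 1)) k) =
      (d : ℂ)⁻¹ • ∑ s : ZMod d, x (k - s) * Φ (y * pz (T m) s) := by
  rw [idem_eq (h.td _ hm)]
  simp only [mul_smul_comm, smul_mul_assoc, Finset.mul_sum, Finset.sum_mul, map_smul, map_sum]
  congr 1
  refine Finset.sum_congr rfl fun s _ => ?_
  rw [show k - s = -s + k by ring, ← H.r2 _ hm _ (mul_mem hy (pz_mem (by omega) _)),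
    pz_add (h.td _ hm)]
  simp only [mul_assoc]

theorem avg_const (c : R) : (d : ℂ)⁻¹ • ∑ _s : ZMod d, c = c := by
  rw [Finset.sum_const, Finset.card_univ, ZMod.card, ← Nat.cast_smul_eq_nsmul ℂ, smul_smul,
    inv_mul_cancel₀ (by exact_mod_cast NeZero.ne d), one_smul]

theorem E2 (h : YRep d N u G T) (H : Rules N G T z x Φ) {m : ℕ} (hm : m + 1 < N) {y b : A}
    (hy : y ∈ Sub G T (m + 1)) (hb : b ∈ Sub G T (m + 1)) :
    Φ (y * idem d (T m) (T (m + 1)) * G m * b) = z * Φ (y * b) := by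
  rw [idem_eq (h.td _ hm)]
  simp only [mul_smul_comm, smul_mul_assoc, Finset.mul_sum, Finset.sum_mul, map_smul, map_sum]
  rw [← avg_const (d := d) (z * Φ (y * b))]
  congr 1
  refine Finset.sum_congr rfl fun s _ => ?_
  have : y * (pz (T m) s * pz (T (m + 1)) (-s)) * G m * b =
      y * pz (T m) s * G m * (pz (T m) (-s) * b) := by
    simp only [mul_assoc]
    rw [← mul_assoc _ (G m), pz_swap (h.tg1 m hm)]
    simp only [mul_assoc]
  rw [this, H.r1 m hm _ (mul_mem hy (pz_mem (by omega) _)) _ (mul_mem (pz_mem (by omega) _) hb),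
    mul_assoc, ← mul_assoc _ _ b, ← pz_add (h.td _ (by omega))]
  simp

theorem E3 (h : YRep d N u G T) (H : Rules N G T z x Φ) {m : ℕ} (hm : m + 1 < N) {a b : A}
    (ha : a ∈ Sub G T (m + 1)) (hb : b ∈ Sub G T (m + 1)) :
    Φ (a * G m * b * idem d (T m) (T (m + 1))) =
      (d : ℂ)⁻¹ • ∑ s : ZMod d, z * Φ (a * pz (T m) (-s) * b * pz (T m) s) := by
  rw [idem_eq (h.td _ hm)]
  simp only [mul_smul_comm, Finset.mul_sum, map_smul, map_sum]
  congr 1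
  refine Finset.sum_congr rfl fun s _ => ?_
  have : a * G m * b * (pz (T m) s * pz (T (m + 1)) (-s)) =
      a * pz (T m) (-s) * G m * (b * pz (T m) s) := by
    calc _ = a * (G m * (b * pz (T m) s * pz (T (m + 1)) (-s))) := by simp only [mul_assoc]
      _ = _ := by
        rw [Sub_comm_pz h (mul_mem hb (pz_mem (by omega) _)) le_rfl hm, ← mul_assoc (G m),
          ← pz_swap (h.tg0 m hm)]
        simp only [mul_assoc]
  rw [this, H.r1 m hm _ (mul_mem ha (pz_mem (by omega) _)) _ (mul_mem hb (pz_mem (by omega) _))]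
  simp only [mul_assoc]

theorem e_comm_G (h : YRep d N u G T) {m : ℕ} (hm : m + 1 < N) :
    idem d (T m) (T (m + 1)) * G m = G m * idem d (T m) (T (m + 1)) := by
  rw [idem_swap (h.tg0 m hm) (h.tg1 m hm), idem_comm (h.td _ (by omega)) (h.td _ (by omega))
    (h.tt _ _ (by omega) (by omega))]

theorem e_comm_T (h : YRep d N u G T) {m j : ℕ} (hm : m + 1 < N) (hj : j < N) (k : ZMod d) :
    pz (T j) k * idem d (T m) (T (m + 1)) = idem d (T m) (T (m + 1)) * pz (T j) k :=
  (idem_swap (pz_swap (h.tt j m hj (by omega)) k).symm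
    (pz_swap (h.tt j (m + 1) hj (by omega)) k).symm).symm

theorem e_comm_Sub (h : YRep d N u G T) {m : ℕ} (hm : m + 1 < N) {c : A} (hc : c ∈ Sub G T m) :
    c * idem d (T m) (T (m + 1)) = idem d (T m) (T (m + 1)) * c :=
  (idem_swap (Sub_comm_T h hc le_rfl (by omega)).symm
    (Sub_comm_T h hc (by omega) (by omega)).symm).symm

theorem T3 (h : YRep d N u G T) (H : Rules N G T z x Φ) {l : ℕ} (hl : l + 1 < N) {a b : A}
    (ha : a ∈ Sub G T (l + 1)) (hb : b ∈ Sub G T (l + 1)) :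
    Φ (b * G l * idem d (T l) (T (l + 1)) * a * G l) =
      Φ (b * G l * a * idem d (T l) (T (l + 1)) * G l) := by
  refine Sub_induct h (m := l) (by omega) (P := fun a =>
    Φ (b * G l * idem d (T l) (T (l + 1)) * a * G l) =
      Φ (b * G l * a * idem d (T l) (T (l + 1)) * G l)) ?_ ?_ ?_ ?_ ?_ ha
  · simp
  · intro x y hx hy; simp only [mul_add, add_mul, map_add, hx, hy]
  · intro c x hx; simp only [mul_smul_comm, smul_mul_assoc, map_smul, hx]
  · intro c hc k
    have : c * pz (T l) k * idem d (T l) (T (l + 1)) =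
        idem d (T l) (T (l + 1)) * (c * pz (T l) k) := by
      rw [mul_assoc c, e_comm_T h hl (by omega), ← mul_assoc c, e_comm_Sub h hl hc, mul_assoc]
    rw [mul_assoc (b * G l) (c * _), this]
    simp only [mul_assoc]
  · rintro r rfl c hc c' hc'
    have hG := h.braid r hl
    have e1 : idem d (T (r + 1)) (T (r + 1 + 1)) * (G r * G (r + 1)) =
        G r * G (r + 1) * idem d (T r) (T (r + 1)) := by
      rw [← mul_assoc, idem_swap (h.tg1 r (by omega))
        (h.tg r (r + 2) (by omega) (by omega) (by omega) (by omega)), mul_assoc,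
        idem_swap (h.tg (r + 1) r (by omega) (by omega) (by omega) (by omega)) (h.tg1 (r + 1) hl),
        mul_assoc]
    have e2 : idem d (T r) (T (r + 1)) * (G (r + 1) * G r) =
        G (r + 1) * G r * idem d (T (r + 1)) (T (r + 1 + 1)) := by
      rw [← mul_assoc, idem_swap (h.tg (r + 1) r (by omega) (by omega) (by omega) (by omega))
        (h.tg0 (r + 1) hl), mul_assoc, idem_swap (h.tg0 r (by omega))
        (h.tg r (r + 2) (by omega) (by omega) (by omega) (by omega)), mul_assoc]
    have ce := e_comm_Sub h hl hc
    have ce' := e_comm_Sub h hl hc'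
    have ge : idem d (T r) (T (r + 1)) * G r = G r * idem d (T r) (T (r + 1)) :=
      e_comm_G h (by omega)
    set e := idem d (T (r + 1)) (T (r + 1 + 1))
    set e' := idem d (T r) (T (r + 1))
    have he' : e' ∈ Sub G T (r + 2) := by
      simp only [e', idem]
      exact Subalgebra.smul_mem _ (sum_mem fun s _ =>
        mul_mem (pow_mem (T_mem (by omega)) _) (pow_mem (T_mem (by omega)) _)) _
    have k1 : b * G (r + 1) * e * (c * G r * c') * G (r + 1) =
        b * c * G r * G (r + 1) * (G r * e' * c') := by
      calc _ = b * G (r + 1) * (e * c) * G r * (c' * G (r + 1)) := by simp only [mul_assoc]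
        _ = b * (G (r + 1) * c) * (e * (G r * G (r + 1))) * c' := by
          rw [← ce, Sub_comm_G h hc' le_rfl hl]; simp only [mul_assoc]
        _ = b * c * (G (r + 1) * G r * G (r + 1)) * e' * c' := by
          rw [← Sub_comm_G h hc le_rfl hl, e1]; simp only [mul_assoc]
        _ = _ := by rw [← hG]; simp only [mul_assoc]
    have k2 : b * G (r + 1) * (c * G r * c') * e * G (r + 1) =
        b * c * e' * G r * G (r + 1) * (G r * c') := by
      calc _ = b * (G (r + 1) * c) * G r * (c' * e) * G (r + 1) := by simp only [mul_assoc]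
        _ = b * c * (G (r + 1) * G r * e) * (c' * G (r + 1)) := by
          rw [ce', ← Sub_comm_G h hc le_rfl hl]; simp only [mul_assoc]
        _ = b * c * e' * (G (r + 1) * G r * G (r + 1)) * c' := by
          rw [Sub_comm_G h hc' le_rfl hl, ← e2]; simp only [mul_assoc]
        _ = _ := by rw [← hG]; simp only [mul_assoc]
    have hc2 := Sub_mono (Nat.le_succ (r + 1)) hc
    have hc2' := Sub_mono (Nat.le_succ (r + 1)) hc'
    have hg : G r ∈ Sub G T (r + 2) := G_mem (by omega)
    rw [k1, k2, H.r1 (r + 1) hl _ (mul_mem (mul_mem hb hc2) hg) _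
      (mul_mem (mul_mem hg he') hc2'), H.r1 (r + 1) hl _
      (mul_mem (mul_mem (mul_mem hb hc2) he') hg) _ (mul_mem hg hc2')]
    congr 2
    have : b * c * G r * (G r * e' * c') = b * c * (G r * (G r * e')) * c' := by
      simp only [mul_assoc]
    rw [this, ← ge, ← mul_assoc (G r), ← ge]
    simp only [mul_assoc]

theorem Qsymm (h : YRep d N u G T) (H : Rules N G T z x Φ) {l : ℕ} (hl : l + 1 < N)
    (htr : ∀ a ∈ Sub G T (l + 2), ∀ b ∈ Sub G T (l + 2), Φ (a * b) = Φ (b * a)) {a b : A}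
    (ha : a ∈ Sub G T (l + 1)) (hb : b ∈ Sub G T (l + 1)) :
    Φ (a * G l * b * (G l * G l)) = Φ (b * G l * a * (G l * G l)) := by
  have up : ∀ {c}, c ∈ Sub G T (l + 1) → c ∈ Sub G T (l + 2) := fun hc =>
    Sub_mono (Nat.le_succ (l + 1)) hc
  have hg : G l ∈ Sub G T (l + 2) := G_mem (by omega)
  have t1 : Φ (a * G l * b) = Φ (b * G l * a) := by
    rw [H.r1 l hl a ha b hb, H.r1 l hl b hb a ha, htr a (up ha) b (up hb)]
  have t2 : Φ (a * G l * b * idem d (T l) (T (l + 1))) =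
      Φ (b * G l * a * idem d (T l) (T (l + 1))) := by
    rw [E3 h H hl ha hb, E3 h H hl hb ha]
    congr 1
    refine Finset.sum_bij' (fun s _ => -s) (fun s _ => -s) ?_ ?_ ?_ ?_ ?_ <;> simp
    intro s
    rw [mul_assoc, htr _ (up (mul_mem ha (pz_mem (by omega) _))) _
      (up (mul_mem hb (pz_mem (by omega) _)))]
    simp only [mul_assoc]
  have he : idem d (T l) (T (l + 1)) ∈ Sub G T (l + 2) := by
    simp only [idem]
    exact Subalgebra.smul_mem _ (sum_mem fun s _ =>
      mul_mem (pow_mem (T_mem (by omega)) _) (pow_mem (T_mem (by omega)) _)) _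
  have t3 : Φ (a * G l * b * (idem d (T l) (T (l + 1)) * G l)) =
      Φ (b * G l * a * (idem d (T l) (T (l + 1)) * G l)) := by
    have := T3 h H hl ha hb
    rw [← mul_assoc (b * G l * a), ← this, mul_assoc (a * G l),
      htr _ (mul_mem (up ha) hg) _ (mul_mem (up hb) (mul_mem he hg)), e_comm_G h hl]
    simp only [mul_assoc]
  rw [h.quad l hl]
  simp only [mul_add, mul_one, mul_smul_comm, map_add, map_smul, t1, t2, t3]

end tracial

section tracial2

variable {d N : ℕ} [NeZero d] {u : ℂ} {A : Type*} [Ring A] [Algebra ℂ A] {G T : ℕ → A}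
  {R : Type*} [CommRing R] [Algebra ℂ R] {z : R} {x : ZMod d → R} {Φ : A →ₗ[ℂ] R}

/-- The value of the functional on `a G_m c t^k G_m`, in terms of `y = a c`. -/
def FF (u : ℂ) (T : ℕ → A) (z : R) (x : ZMod d → R) (Φ : A →ₗ[ℂ] R) (m : ℕ) (y : A)
    (k : ZMod d) : R :=
  x k * Φ y + (u - 1) • ((d : ℂ)⁻¹ • ∑ s : ZMod d, x (k - s) * Φ (y * pz (T m) s)) +
    (u - 1) • (z * Φ (y * pz (T m) k))

theorem F_eq (h : YRep d N u G T) (H : Rules N G T z x Φ) {m : ℕ} (hm : m + 1 < N) {a c : A}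
    (ha : a ∈ Sub G T (m + 1)) (hc : c ∈ Sub G T m) (k : ZMod d) :
    Φ (a * G m * (c * pz (T m) k) * G m) = FF u T z x Φ m (a * c) k := by
  have hy : a * c ∈ Sub G T (m + 1) := mul_mem ha (Sub_mono (Nat.le_succ m) hc)
  have e0 : a * G m * (c * pz (T m) k) * G m = a * c * (G m * G m) * pz (T (m + 1)) k := by
    calc _ = a * (G m * c) * (pz (T m) k * G m) := by simp only [mul_assoc]
      _ = _ := by
        rw [← Sub_comm_G h hc le_rfl hm, pz_swap (h.tg0 m hm)]; simp only [mul_assoc]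
  have e1 : a * c * (idem d (T m) (T (m + 1)) * G m) * pz (T (m + 1)) k =
      a * c * pz (T m) k * idem d (T m) (T (m + 1)) * G m * 1 := by
    rw [mul_assoc _ _ (pz (T (m + 1)) k), mul_assoc _ (G m), ← pz_swap (h.tg0 m hm),
      mul_assoc (a * c) (pz (T m) k), e_comm_T h hm (by omega)]
    simp only [mul_assoc, mul_one]
  rw [e0, h.quad m hm, FF]
  simp only [mul_add, add_mul, mul_one, mul_smul_comm, smul_mul_assoc, map_add, map_smul]
  rw [E1 h H hm hy, H.r2 _ hm _ hy, e1, E2 h H hm (mul_mem hy (pz_mem (by omega) _)) (one_mem _),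
    mul_one]

theorem GG_eq (h : YRep d N u G T) (H : Rules N G T z x Φ) {l : ℕ} (hl : l + 2 < N) {a c c' : A}
    (ha : a ∈ Sub G T (l + 2)) (hc : c ∈ Sub G T (l + 1)) (hc' : c' ∈ Sub G T (l + 1)) :
    Φ (a * G (l + 1) * (c * G l * c') * G (l + 1)) = z * Φ (a * c * (G l * G l) * c') := by
  have hg : G l ∈ Sub G T (l + 2) := G_mem (by omega)
  have up : ∀ {c}, c ∈ Sub G T (l + 1) → c ∈ Sub G T (l + 2) := fun hc =>
    Sub_mono (Nat.le_succ (l + 1)) hc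
  have e0 : a * G (l + 1) * (c * G l * c') * G (l + 1) =
      a * c * G l * G (l + 1) * (G l * c') := by
    calc _ = a * (G (l + 1) * c) * G l * (c' * G (l + 1)) := by simp only [mul_assoc]
      _ = a * c * (G (l + 1) * G l * G (l + 1)) * c' := by
        rw [← Sub_comm_G h hc le_rfl hl, Sub_comm_G h hc' le_rfl hl]; simp only [mul_assoc]
      _ = _ := by rw [← h.braid l hl]; simp only [mul_assoc]
  rw [e0, H.r1 (l + 1) hl _ (mul_mem (mul_mem ha (up hc)) hg) _ (mul_mem hg (up hc'))]
  simp only [mul_assoc]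

theorem symm_gt (h : YRep d N u G T) (H : Rules N G T z x Φ) {l : ℕ} (hl : l + 2 < N)
    (htr : ∀ a ∈ Sub G T (l + 2), ∀ b ∈ Sub G T (l + 2), Φ (a * b) = Φ (b * a)) {c c1 c2 : A}
    (hc : c ∈ Sub G T (l + 1)) (h1 : c1 ∈ Sub G T (l + 1)) (h2 : c2 ∈ Sub G T (l + 1))
    (k : ZMod d) :
    Φ (c1 * G l * c2 * G (l + 1) * (c * pz (T (l + 1)) k) * G (l + 1)) =
      Φ (c * pz (T (l + 1)) k * G (l + 1) * (c1 * G l * c2) * G (l + 1)) := by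
  have hg : G l ∈ Sub G T (l + 2) := G_mem (by omega)
  have up : ∀ {c}, c ∈ Sub G T (l + 1) → c ∈ Sub G T (l + 2) := fun hc =>
    Sub_mono (Nat.le_succ (l + 1)) hc
  have hp : ∀ s : ZMod d, pz (T l) s ∈ Sub G T (l + 1) := fun s => pz_mem (by omega) s
  have ht : ∀ s : ZMod d, pz (T (l + 1)) s ∈ Sub G T (l + 2) := fun s => pz_mem (by omega) s
  have k1 : ∀ s : ZMod d, Φ (c1 * G l * c2 * c * pz (T (l + 1)) s) =
      z * Φ (c1 * pz (T l) s * c2 * c) := by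
    intro s
    have : c1 * G l * c2 * c * pz (T (l + 1)) s = c1 * pz (T l) s * G l * (c2 * c) := by
      calc _ = c1 * (G l * (c2 * c * pz (T (l + 1)) s)) := by simp only [mul_assoc]
        _ = _ := by
          rw [Sub_comm_pz h (mul_mem h2 hc) le_rfl (by omega), ← mul_assoc (G l),
            ← pz_swap (h.tg0 l (by omega))]
          simp only [mul_assoc]
    rw [this, H.r1 l (by omega) _ (mul_mem h1 (hp s)) _ (mul_mem h2 hc)]
    simp only [mul_assoc]
  have cyc : ∀ s : ZMod d, Φ (c1 * pz (T l) s * c2 * c) = Φ (c * c1 * pz (T l) s * c2) := by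
    intro s
    rw [htr _ (up (mul_mem (mul_mem h1 (hp s)) h2)) _ (up hc)]
    simp only [mul_assoc]
  have l1 : Φ (c * pz (T (l + 1)) k * c1 * c2) = x k * Φ (c * c1 * c2) := by
    rw [← H.r2 (l + 1) (by omega) _ (mul_mem (mul_mem hc h1) h2)]
    congr 1
    calc _ = c * (pz (T (l + 1)) k * (c1 * c2)) := by simp only [mul_assoc]
      _ = _ := by
        rw [← Sub_comm_pz h (mul_mem h1 h2) le_rfl (by omega)]; simp only [mul_assoc]
  have l2 : Φ (c * pz (T (l + 1)) k * c1 * idem d (T l) (T (l + 1)) * c2) =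
      (d : ℂ)⁻¹ • ∑ s : ZMod d, x (k - s) * Φ (c * c1 * pz (T l) s * c2) := by
    rw [idem_eq (h.td _ (by omega))]
    simp only [mul_smul_comm, smul_mul_assoc, Finset.mul_sum, Finset.sum_mul, map_smul, map_sum]
    congr 1
    refine Finset.sum_congr rfl fun s _ => ?_
    rw [← H.r2 (l + 1) (by omega) _ (mul_mem (mul_mem (mul_mem hc h1) (hp s)) h2),
      sub_eq_add_neg, pz_add (h.td _ (by omega))]
    congr 1
    calc _ = c * (pz (T (l + 1)) k * (c1 * pz (T l) s)) * (pz (T (l + 1)) (-s) * c2) := by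
          simp only [mul_assoc]
      _ = c * (c1 * pz (T l) s) * pz (T (l + 1)) k * (c2 * pz (T (l + 1)) (-s)) := by
          rw [← Sub_comm_pz h (mul_mem h1 (hp s)) le_rfl (by omega),
            ← Sub_comm_pz h h2 le_rfl (by omega)]
          simp only [mul_assoc]
      _ = c * (c1 * pz (T l) s) * (c2 * pz (T (l + 1)) k) * pz (T (l + 1)) (-s) := by
          rw [Sub_comm_pz h h2 (j := l + 1) le_rfl (by omega) k]
          simp only [mul_assoc]
      _ = _ := by simp only [mul_assoc]
  have l3 : Φ (c * pz (T (l + 1)) k * c1 * (idem d (T l) (T (l + 1)) * G l) * c2) =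
      z * Φ (c * c1 * pz (T l) k * c2) := by
    have : c * pz (T (l + 1)) k * c1 * (idem d (T l) (T (l + 1)) * G l) * c2 =
        c * c1 * idem d (T l) (T (l + 1)) * G l * (pz (T l) k * c2) := by
      calc _ = c * (pz (T (l + 1)) k * c1) * (idem d (T l) (T (l + 1)) * G l) * c2 := by
            simp only [mul_assoc]
        _ = c * c1 * (pz (T (l + 1)) k * idem d (T l) (T (l + 1))) * G l * c2 := by
            rw [← Sub_comm_pz h h1 le_rfl (by omega)]; simp only [mul_assoc]
        _ = c * c1 * idem d (T l) (T (l + 1)) * (pz (T (l + 1)) k * G l) * c2 := by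
            rw [e_comm_T h (by omega) (by omega)]; simp only [mul_assoc]
        _ = _ := by rw [pz_swap (h.tg1 l (by omega))]; simp only [mul_assoc]
    rw [this, E2 h H (by omega) (mul_mem hc h1) (mul_mem (hp k) h2)]
    simp only [mul_assoc]
  rw [F_eq h H hl (mul_mem (mul_mem (up h1) hg) (up h2)) hc,
    GG_eq h H hl (mul_mem (up hc) (ht k)) h1 h2, h.quad l (by omega), FF]
  simp only [mul_add, add_mul, mul_one, mul_smul_comm, smul_mul_assoc, map_add, map_smul, l1, l2,
    l3, k1, cyc]
  have k0 := k1 0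
  rw [cyc 0] at k0
  simp only [pz_zero, mul_one] at k0
  rw [k0]
  simp only [mul_smul_comm, Finset.mul_sum, smul_smul]
  congr 2
  · ring
  · congr 1
    exact Finset.sum_congr rfl fun s _ => by ring

theorem symm_h (h : YRep d N u G T) (H : Rules N G T z x Φ) {m : ℕ} (hm : m + 1 < N)
    (htr : ∀ a ∈ Sub G T (m + 1), ∀ b ∈ Sub G T (m + 1), Φ (a * b) = Φ (b * a)) {a b : A}
    (ha : a ∈ Sub G T (m + 1)) (hb : b ∈ Sub G T (m + 1)) :
    Φ (a * G m * b * G m) = Φ (b * G m * a * G m) := by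
  refine Sub_induct h (m := m) (by omega)
    (P := fun b => Φ (a * G m * b * G m) = Φ (b * G m * a * G m)) ?_ ?_ ?_ ?_ ?_ hb
  · simp
  · intro x y hx hy; simp only [mul_add, add_mul, map_add, hx, hy]
  · intro c x hx; simp only [mul_smul_comm, smul_mul_assoc, map_smul, hx]
  · intro c hc k
    have hc' := Sub_mono (Nat.le_succ m) hc
    refine Sub_induct h (m := m) (by omega)
      (P := fun a => Φ (a * G m * (c * pz (T m) k) * G m) = Φ (c * pz (T m) k * G m * a * G m))
      ?_ ?_ ?_ ?_ ?_ ha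
    · simp
    · intro x y hx hy; simp only [mul_add, add_mul, map_add, hx, hy]
    · intro c x hx; simp only [mul_smul_comm, smul_mul_assoc, map_smul, hx]
    · intro c1 h1 l
      have h1' := Sub_mono (Nat.le_succ m) h1
      have hmm : m < N := by omega
      have val : ∀ {c c1 : A}, c ∈ Sub G T m → c1 ∈ Sub G T m → ∀ k l : ZMod d,
          FF u T z x Φ m (c1 * pz (T m) l * c) k = x k * (x l * Φ (c1 * c)) +
            (u - 1) • ((d : ℂ)⁻¹ • ∑ s : ZMod d, x (k - s) * (x (l + s) * Φ (c1 * c))) +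
            (u - 1) • (z * (x (l + k) * Φ (c1 * c))) := by
        intro c c1 hc h1 k l
        have e : ∀ s : ZMod d, c1 * pz (T m) l * c * pz (T m) s = c1 * c * pz (T m) (l + s) := by
          intro s
          rw [mul_assoc c1, ← Sub_comm_pz h hc le_rfl hmm, pz_add (h.td _ hmm)]
          simp only [mul_assoc]
        have e' : c1 * pz (T m) l * c = c1 * c * pz (T m) l := by simpa using e 0
        have hr : ∀ s : ZMod d, Φ (c1 * c * pz (T m) s) = x s * Φ (c1 * c) :=
          fun s => H.r2 m hmm _ (mul_mem h1 hc) s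
        simp only [FF, e, hr]
        rw [e', hr]
      rw [F_eq h H hm (mul_mem h1' (pz_mem (by omega) _)) hc,
        F_eq h H hm (mul_mem hc' (pz_mem (by omega) _)) h1, val hc h1, val h1 hc,
        htr c1 h1' c hc']
      congr 1
      · congr 1
        · ring
        · congr 2
          refine Finset.sum_bij' (fun s _ => -s) (fun s _ => -s) ?_ ?_ ?_ ?_ ?_ <;> simp
          intro s
          rw [← sub_eq_add_neg]
          ring
      · rw [add_comm k l]
    · rintro l rfl c1 h1 c2 h2
      exact symm_gt h H hm htr hc h1 h2 k
  · rintro l rfl c3 h3 c4 h4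
    have hg : G l ∈ Sub G T (l + 2) := G_mem (by omega)
    have up : ∀ {c}, c ∈ Sub G T (l + 1) → c ∈ Sub G T (l + 2) := fun hc =>
      Sub_mono (Nat.le_succ (l + 1)) hc
    refine Sub_induct h (m := l + 1) (by omega)
      (P := fun a => Φ (a * G (l + 1) * (c3 * G l * c4) * G (l + 1)) =
        Φ (c3 * G l * c4 * G (l + 1) * a * G (l + 1))) ?_ ?_ ?_ ?_ ?_ ha
    · simp
    · intro x y hx hy; simp only [mul_add, add_mul, map_add, hx, hy]
    · intro c x hx; simp only [mul_smul_comm, smul_mul_assoc, map_smul, hx]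
    · intro c hc k
      exact (symm_gt h H hm htr hc h3 h4 k).symm
    · intro l' hl' c1 h1 c2 h2
      obtain rfl : l = l' := by omega
      have key : ∀ {c1 c2 c3 c4 : A}, c1 ∈ Sub G T (l + 1) → c2 ∈ Sub G T (l + 1) →
          c3 ∈ Sub G T (l + 1) → c4 ∈ Sub G T (l + 1) →
          Φ (c1 * G l * c2 * c3 * (G l * G l) * c4) =
            Φ (c4 * c1 * G l * (c2 * c3) * (G l * G l)) := by
        intro c1 c2 c3 c4 h1 h2 h3 h4
        rw [htr _ (mul_mem (mul_mem (mul_mem (mul_mem (up h1) hg) (up h2)) (up h3))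
          (mul_mem hg hg)) _ (up h4)]
        simp only [mul_assoc]
      rw [GG_eq h H hm (mul_mem (mul_mem (up h1) hg) (up h2)) h3 h4,
        GG_eq h H hm (mul_mem (mul_mem (up h3) hg) (up h4)) h1 h2, key h1 h2 h3 h4,
        key h3 h4 h1 h2, Qsymm h H (by omega) htr (mul_mem h4 h1) (mul_mem h2 h3)]

theorem tracial_step {n : ℕ} (h : YRep d (n + 1) u G T) (H : Rules (n + 1) G T z x Φ)
    (htr : ∀ a ∈ Sub G T n, ∀ b ∈ Sub G T n, Φ (a * b) = Φ (b * a)) {a b : A}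
    (ha : a ∈ Sub G T (n + 1)) (hb : b ∈ Sub G T (n + 1)) : Φ (a * b) = Φ (b * a) := by
  have base : ∀ s ∈ Sub G T n, ∀ b ∈ Sub G T (n + 1), Φ (s * b) = Φ (b * s) := by
    intro s hs b hb
    refine Sub_induct h (m := n) (by omega) (P := fun b => Φ (s * b) = Φ (b * s)) ?_ ?_ ?_ ?_ ?_ hb
    · simp
    · intro x y hx hy; simp only [mul_add, add_mul, map_add, hx, hy]
    · intro c x hx; simp only [mul_smul_comm, smul_mul_assoc, map_smul, hx]
    · intro c hc k
      rw [mul_assoc c, ← Sub_comm_pz h hs le_rfl (by omega), ← mul_assoc, ← mul_assoc,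
        H.r2 n (by omega) _ (mul_mem hs hc), H.r2 n (by omega) _ (mul_mem hc hs), htr s hs c hc]
    · rintro l rfl c1 h1 c2 h2
      rw [← mul_assoc, ← mul_assoc, mul_assoc _ c2, H.r1 l (by omega) _ (mul_mem hs h1) _ h2,
        H.r1 l (by omega) _ h1 _ (mul_mem h2 hs), mul_assoc s, htr s hs _ (mul_mem h1 h2),
        mul_assoc]
  induction ha using Algebra.adjoin_induction generalizing b with
  | mem y hy =>
    by_cases hyn : y ∈ Sub G T n
    · exact base y hyn b hb
    rcases hy with ⟨i, hi, rfl⟩ | ⟨j, hj, rfl⟩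
    · obtain rfl : n = i + 1 := by
        by_contra hne
        exact hyn (G_mem (by omega))
      refine Sub_induct h (m := i + 1) (by omega) (P := fun b => Φ (G i * b) = Φ (b * G i))
        ?_ ?_ ?_ ?_ ?_ hb
      · simp
      · intro x y hx hy; simp only [mul_add, add_mul, map_add, hx, hy]
      · intro c x hx; simp only [mul_smul_comm, smul_mul_assoc, map_smul, hx]
      · intro c hc k
        have hp : pz (T i) k ∈ Sub G T (i + 1) := pz_mem (by omega) _
        have e1 : G i * (c * pz (T (i + 1)) k) = pz (T i) k * G i * c := by
          rw [Sub_comm_pz h hc le_rfl (by omega), ← mul_assoc, ← pz_swap (h.tg0 i (by omega))]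
        have e2 : c * pz (T (i + 1)) k * G i = c * G i * pz (T i) k := by
          rw [mul_assoc, pz_swap (h.tg1 i (by omega)), mul_assoc]
        rw [e1, e2, H.r1 i (by omega) _ hp _ hc, H.r1 i (by omega) _ hc _ hp, htr _ hp _ hc]
      · intro l hl c1 h1 c2 h2
        obtain rfl : i = l := by omega
        have := symm_h h H (by omega) htr h1 h2
        rw [this, mul_assoc c2, mul_assoc c2, base c2 h2 _ ?_]
        · simp only [mul_assoc]
        · exact mul_mem (mul_mem (G_mem (by omega)) (Sub_mono (Nat.le_succ _) h1))
            (G_mem (by omega))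
    · obtain rfl : n = j := by
        by_contra hne
        exact hyn (T_mem (by omega))
      refine Sub_induct h (m := n) (by omega) (P := fun b => Φ (T n * b) = Φ (b * T n))
        ?_ ?_ ?_ ?_ ?_ hb
      · simp
      · intro x y hx hy; simp only [mul_add, add_mul, map_add, hx, hy]
      · intro c x hx; simp only [mul_smul_comm, smul_mul_assoc, map_smul, hx]
      · intro c hc k
        rw [← mul_assoc, ← Sub_comm_T h hc le_rfl (by omega), mul_assoc, mul_assoc]
        congr 2
        exact (Commute.pow_right rfl _ : Commute (T n) (pz (T n) k)).eq
      · rintro l rfl c1 h1 c2 h2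
        have ht : T l ∈ Sub G T (l + 1) := T_mem (by omega)
        have e1 : T (l + 1) * (c1 * G l * c2) = c1 * G l * (T l * c2) := by
          rw [← mul_assoc, ← mul_assoc, ← Sub_comm_T h h1 le_rfl (by omega), mul_assoc c1,
            h.tg1 l (by omega)]
          simp only [mul_assoc]
        have e2 : c1 * G l * c2 * T (l + 1) = c1 * T l * G l * c2 := by
          rw [mul_assoc _ c2, Sub_comm_T h h2 le_rfl (by omega), ← mul_assoc, mul_assoc c1,
            ← h.tg0 l (by omega)]
          simp only [mul_assoc]
        rw [e1, e2, H.r1 l (by omega) _ h1 _ (mul_mem ht h2),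
          H.r1 l (by omega) _ (mul_mem h1 ht) _ h2, mul_assoc]
  | algebraMap c => rw [Algebra.commutes]
  | add y z _ _ h1 h2 => rw [add_mul, mul_add, map_add, map_add, h1 hb, h2 hb]
  | mul y z hy hz h1 h2 =>
    rw [mul_assoc, h1 (mul_mem hz hb), mul_assoc, h2 (mul_mem hb hy), mul_assoc]

end tracial2

/- The natural inclusions, and the construction of the traces strand by strand. -/

section construction

variable {d : ℕ} {u : ℂ}

theorem Y.ind {n : ℕ} {P : Y d n u → Prop} (halg : ∀ c : ℂ, P (algebraMap ℂ _ c))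
    (hg : ∀ i, i + 1 < n → P (Y.gN d n u i)) (ht : ∀ j, j < n → P (Y.tN d n u j))
    (hadd : ∀ a b, P a → P b → P (a + b)) (hmul : ∀ a b, P a → P b → P (a * b)) (y : Y d n u) :
    P y := by
  obtain ⟨a, rfl⟩ : ∃ a, Y.mk d n u a = y := RingQuot.mkAlgHom_surjective ℂ _ y
  induction a using FreeAlgebra.induction with
  | grade0 c => rw [AlgHom.commutes]; exact halg c
  | grade1 x =>
    cases x with
    | g i =>
      have := hg i (by omega)
      rwa [Y.gN, dif_pos i.2] at this
    | t j =>
      have := ht j j.2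
      rwa [Y.tN, dif_pos j.2] at this
  | mul a b ha hb => rw [map_mul]; exact hmul _ _ ha hb
  | add a b ha hb => rw [map_add]; exact hadd _ _ ha hb

theorem Y.mem_Sub {n : ℕ} (y : Y d n u) : y ∈ Sub (Y.gN d n u) (Y.tN d n u) n :=
  Y.ind (P := fun y => y ∈ Sub (Y.gN d n u) (Y.tN d n u) n) (fun c => Subalgebra.algebraMap_mem _ c)
    (fun _ hi => G_mem hi) (fun _ hj => T_mem hj) (fun _ _ => add_mem) (fun _ _ => mul_mem) y

/-- The natural map `Y_{d,n}(u) → Y_{d,n+1}(u)`, sending `g_i` to `g_i` and `t_j` to `t_j`. -/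
def Y.incl (d n : ℕ) (u : ℂ) : Y d n u →ₐ[ℂ] Y d (n + 1) u :=
  Y.lift ((Y.rep d (n + 1) u).mono (Nat.le_succ n))

theorem Y.incl_g {n : ℕ} (i : Fin (n - 1)) :
    Y.incl d n u (Y.g d u i) = Y.g d (n := n + 1) u ⟨i, by omega⟩ := by
  rw [Y.incl, Y.lift_g, Y.gN, dif_pos (by omega)]

theorem Y.incl_t {n : ℕ} (j : Fin n) :
    Y.incl d n u (Y.t d u j) = Y.t d (n := n + 1) u j.castSucc := by
  rw [Y.incl, Y.lift_t, Y.tN, dif_pos (by omega)]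
  rfl

theorem Y.incl_gN {n i : ℕ} (h : i + 1 < n) : Y.incl d n u (Y.gN d n u i) = Y.gN d (n + 1) u i := by
  rw [Y.gN, dif_pos (by omega), Y.incl, Y.lift_g]

theorem Y.incl_tN {n j : ℕ} (h : j < n) : Y.incl d n u (Y.tN d n u j) = Y.tN d (n + 1) u j := by
  rw [Y.tN, dif_pos h, Y.incl, Y.lift_t]

theorem Y.lift_gN {n : ℕ} {A : Type*} [Ring A] [Algebra ℂ A] {G T : ℕ → A}
    (h : YRep d n u G T) {i : ℕ} (hi : i + 1 < n) : Y.lift h (Y.gN d n u i) = G i := by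
  rw [Y.gN, dif_pos (by omega), Y.lift_g]

theorem Y.lift_tN {n : ℕ} {A : Type*} [Ring A] [Algebra ℂ A] {G T : ℕ → A}
    (h : YRep d n u G T) {j : ℕ} (hj : j < n) : Y.lift h (Y.tN d n u j) = T j := by
  rw [Y.tN, dif_pos hj, Y.lift_t]

theorem Y.incl_Sub {n m : ℕ} (hm : m ≤ n) {y : Y d (n + 1) u}
    (hy : y ∈ Sub (Y.gN d (n + 1) u) (Y.tN d (n + 1) u) m) :
    ∃ a ∈ Sub (Y.gN d n u) (Y.tN d n u) m, Y.incl d n u a = y := by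
  have : Sub (Y.gN d (n + 1) u) (Y.tN d (n + 1) u) m ≤
      (Sub (Y.gN d n u) (Y.tN d n u) m).map (Y.incl d n u) := by
    refine Algebra.adjoin_le ?_
    rintro _ (⟨i, hi, rfl⟩ | ⟨j, hj, rfl⟩)
    · exact ⟨_, G_mem hi, Y.incl_gN (by omega)⟩
    · exact ⟨_, T_mem hj, Y.incl_tN (by omega)⟩
  exact this hy

theorem Y.incl_mem {n m : ℕ} (hm : m ≤ n) {a : Y d n u}
    (ha : a ∈ Sub (Y.gN d n u) (Y.tN d n u) m) :
    Y.incl d n u a ∈ Sub (Y.gN d (n + 1) u) (Y.tN d (n + 1) u) m := by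
  have : Sub (Y.gN d n u) (Y.tN d n u) m ≤
      (Sub (Y.gN d (n + 1) u) (Y.tN d (n + 1) u) m).comap (Y.incl d n u) := by
    refine Algebra.adjoin_le ?_
    rintro _ (⟨i, hi, rfl⟩ | ⟨j, hj, rfl⟩)
    · change Y.incl d n u _ ∈ Sub _ _ _
      rw [Y.incl_gN (by omega)]; exact G_mem hi
    · change Y.incl d n u _ ∈ Sub _ _ _
      rw [Y.incl_tN (by omega)]; exact T_mem hj
  exact this ha

variable [NeZero d]

/-- The coefficient ring `Y_{d,n}(u)[ℤ/d]`. -/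
abbrev CA (d n : ℕ) (u : ℂ) : Type := AddMonoidAlgebra (Y d n u) (ZMod d)

/-- The inclusion of coefficients. -/
abbrev cin (d n : ℕ) (u : ℂ) : Y d n u →ₐ[ℂ] CA d n u := AddMonoidAlgebra.singleZeroAlgHom

/-- The central element. -/
def ctau (d n : ℕ) (u : ℂ) : CA d n u := AddMonoidAlgebra.single 1 1

theorem ctau_comm (n : ℕ) (a : CA d n u) : ctau d n u * a = a * ctau d n u :=
  AddMonoidAlgebra.single_commute (fun _ => add_comm _ _) (fun _ => Commute.one_left _) a

theorem ctau_pow (n k : ℕ) : ctau d n u ^ k = AddMonoidAlgebra.single (k : ZMod d) 1 := by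
  rw [ctau, AddMonoidAlgebra.single_pow]
  simp

theorem ctau_pow_d (n : ℕ) : ctau d n u ^ d = 1 := by
  rw [ctau_pow]; simp [AddMonoidAlgebra.one_def]

/-- The right action of `Y_{d,n+1}(u)` on the free module of rank `n + 1`. -/
def Y.act (d n : ℕ) [NeZero d] (u : ℂ) : Y d (n + 1) u →ₐ[ℂ] ROp (CA d n u) n :=
  Y.lift (rop_rep ((Y.rep d n u).map (cin d n u)) (ctau_comm n) (ctau_pow_d n))

/-- The action on vectors. -/
def Y.av {n : ℕ} (y : Y d (n + 1) u) (v : Fin (n + 1) →₀ CA d n u) : Fin (n + 1) →₀ CA d n u :=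
  (Y.act d n u y).unop v

theorem Y.av_mul {n : ℕ} (y y' : Y d (n + 1) u) (v : Fin (n + 1) →₀ CA d n u) :
    Y.av (y * y') v = Y.av y' (Y.av y v) := by
  simp only [Y.av, map_mul, rop_mul]

theorem Y.av_smul {n : ℕ} (y : Y d (n + 1) u) (c : CA d n u) (v : Fin (n + 1) →₀ CA d n u) :
    Y.av y (c • v) = c • Y.av y v := by
  simp only [Y.av, map_smul]

theorem Y.av_one {n : ℕ} (v : Fin (n + 1) →₀ CA d n u) : Y.av (1 : Y d (n + 1) u) v = v := by
  simp [Y.av]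

theorem Y.av_g {n i : ℕ} (h : i < n) (v : Fin (n + 1) →₀ CA d n u) :
    Y.av (Y.gN d (n + 1) u i) v =
      opG d n u (fun i => cin d n u (Y.gN d n u i)) (fun i => cin d n u (Y.tN d n u i))
        (ctau d n u) i v := by
  rw [Y.av, Y.act, Y.lift_gN _ (by omega)]
  rfl

theorem Y.av_t {n i : ℕ} (h : i ≤ n) (v : Fin (n + 1) →₀ CA d n u) :
    Y.av (Y.tN d (n + 1) u i) v =
      opT n (fun i => cin d n u (Y.tN d n u i)) (ctau d n u) i v := by
  rw [Y.av, Y.act, Y.lift_tN _ (by omega)]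
  rfl

theorem Y.av_tpow {n i : ℕ} (h : i ≤ n) (k : ZMod d) :
    Y.av (pz (Y.tN d (n + 1) u i) k) (bv _ n i) =
      (AddMonoidAlgebra.single k 1 : CA d n u) • bv _ n i := by
  rw [pz, Y.av, map_pow, rop_pow _ (ctau d n u), ctau_pow]
  · simp
  · exact (Y.av_t h _).trans (opT_self _ _ _ h)

theorem Y.av_W {n i r : ℕ} (h : i + r ≤ n) :
    Y.av (W (Y.gN d (n + 1) u) i r) (bv _ n (i + r)) = bv (CA d n u) n i := by
  induction r generalizing i with
  | zero => simp [W, Y.av_one]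
  | succ r ih =>
    have := ih (i := i + 1) (by omega)
    rw [W, Y.av_mul, show i + (r + 1) = i + 1 + r by omega, this, Y.av_g (by omega),
      opG_succ _ _ _ _ (by omega)]

theorem Y.av_incl {n : ℕ} (a : Y d n u) :
    Y.av (Y.incl d n u a) (bv _ n n) = cin d n u a • bv _ n n := by
  induction a using Y.ind with
  | halg c =>
    rw [AlgHom.commutes, AlgHom.commutes, Y.av, AlgHom.commutes]
    simp [Algebra.algebraMap_eq_smul_one]
  | hg i hi =>
    rw [Y.incl_gN hi, Y.av_g (by omega), opG_gt _ _ _ _ _ le_rfl (by omega)]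
  | ht j hj =>
    rw [Y.incl_tN hj, Y.av_t (by omega), opT_gt _ _ _ _ le_rfl (by omega)]
  | hadd a b ha hb =>
    rw [map_add, map_add, add_smul, ← ha, ← hb]
    simp [Y.av]
  | hmul a b ha hb =>
    rw [map_mul, map_mul, Y.av_mul, ha, Y.av_smul, hb, smul_smul]

variable {R : Type*} [CommRing R] [Algebra ℂ R] (z : R) (x : ZMod d → R)

/-- The functional on the coefficient of the `i`-th basis vector. -/
def psi {n : ℕ} (φ : Y d n u →ₗ[ℂ] R) (i : ℕ) (k : ZMod d) : Y d n u →ₗ[ℂ] R :=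
  if i = n then x k • φ else
    z • (φ ∘ₗ LinearMap.mulRight ℂ (W (Y.gN d n u) i (n - 1 - i) * pz (Y.tN d n u i) k))

/-- The functional on the free module. -/
def LL {n : ℕ} (φ : Y d n u →ₗ[ℂ] R) : (Fin (n + 1) →₀ CA d n u) →ₗ[ℂ] R where
  toFun v := ∑ i : Fin (n + 1), ∑ k : ZMod d, psi z x φ i k ((v i).coeff k)
  map_add' v w := by simp [Finset.sum_add_distrib]
  map_smul' c v := by simp [Finset.smul_sum]

theorem LL_single {n : ℕ} (φ : Y d n u →ₗ[ℂ] R) {i : ℕ} (hi : i ≤ n) (k : ZMod d) (a : Y d n u) :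
    LL z x φ ((AddMonoidAlgebra.single k a : CA d n u) • bv _ n i) = psi z x φ i k a := by
  simp only [LL, LinearMap.coe_mk, AddHom.coe_mk, bv, dif_pos (Nat.lt_succ_of_le hi)]
  rw [Finset.sum_eq_single ⟨i, Nat.lt_succ_of_le hi⟩, Finset.sum_eq_single k]
  · simp
  · intro l _ hl; simp [Finsupp.single_apply, hl.symm]
  · simp
  · intro l _ hl
    refine Finset.sum_eq_zero fun k _ => ?_
    simp [Finsupp.single_apply, hl.symm]
  · simp

/-- The functional on `Y_{d,n+1}(u)` extending a functional on `Y_{d,n}(u)`. -/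
def stepTr {n : ℕ} (φ : Y d n u →ₗ[ℂ] R) : Y d (n + 1) u →ₗ[ℂ] R where
  toFun y := LL z x φ (Y.av y (bv _ n n))
  map_add' y y' := by simp [Y.av]
  map_smul' c y := by simp [Y.av]

variable {z x}

theorem stepTr_apply {n : ℕ} (φ : Y d n u →ₗ[ℂ] R) (y : Y d (n + 1) u) :
    stepTr z x φ y = LL z x φ (Y.av y (bv _ n n)) := rfl

theorem stepTr_t {n : ℕ} (φ : Y d n u →ₗ[ℂ] R) (a : Y d n u) (k : ZMod d) :
    stepTr z x φ (Y.incl d n u a * pz (Y.tN d (n + 1) u n) k) = x k * φ a := by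
  rw [stepTr_apply, Y.av_mul, Y.av_incl, Y.av_smul, Y.av_tpow le_rfl, smul_smul]
  have : cin d n u a * AddMonoidAlgebra.single k 1 = AddMonoidAlgebra.single k a := by
    simp [AddMonoidAlgebra.single_mul_single]
  rw [this, LL_single _ _ _ le_rfl]
  simp [psi]

theorem stepTr_incl (hx : x 0 = 1) {n : ℕ} (φ : Y d n u →ₗ[ℂ] R) (a : Y d n u) :
    stepTr z x φ (Y.incl d n u a) = φ a := by
  simpa [hx] using stepTr_t (z := z) (x := x) φ a 0

theorem stepTr_g {n : ℕ} (φ : Y d (n + 1) u →ₗ[ℂ] R) (a : Y d (n + 1) u) {i r : ℕ}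
    (hir : i + r = n) (k : ZMod d) :
    stepTr z x φ (Y.incl d (n + 1) u a * Y.gN d (n + 2) u n *
      (W (Y.gN d (n + 2) u) i r * pz (Y.tN d (n + 2) u i) k)) =
      z * φ (a * (W (Y.gN d (n + 1) u) i r * pz (Y.tN d (n + 1) u i) k)) := by
  subst hir
  rw [stepTr_apply, Y.av_mul, Y.av_mul, Y.av_mul, Y.av_incl, Y.av_smul, Y.av_g (by omega), opG_succ _ _ _ _ (by omega),
    Y.av_smul, Y.av_W (by omega), Y.av_smul, Y.av_tpow (by omega), smul_smul]
  have : cin d (i + r + 1) u a * AddMonoidAlgebra.single k 1 = AddMonoidAlgebra.single k a := by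
    simp [AddMonoidAlgebra.single_mul_single]
  rw [this, LL_single _ _ _ (by omega), psi, if_neg (by omega)]
  simp [mul_assoc]

theorem W_incl {n i r : ℕ} (h : i + r < n) :
    Y.incl d n u (W (Y.gN d n u) i r) = W (Y.gN d (n + 1) u) i r := by
  induction r generalizing i with
  | zero => simp [W]
  | succ r ih => rw [W, map_mul, ih (by omega), Y.incl_gN (by omega), W]

theorem stepTr_rules (hx : x 0 = 1) {n : ℕ} (φ : Y d n u →ₗ[ℂ] R)
    (H : Rules n (Y.gN d n u) (Y.tN d n u) z x φ) :
    Rules (n + 1) (Y.gN d (n + 1) u) (Y.tN d (n + 1) u) z x (stepTr z x φ) where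
  r1 m hm a ha b hb := by
    obtain ⟨a, ha', rfl⟩ := Y.incl_Sub (by omega) ha
    obtain ⟨b, hb', rfl⟩ := Y.incl_Sub (by omega) hb
    rw [← map_mul (Y.incl d n u), stepTr_incl hx]
    rcases Nat.lt_or_ge (m + 1) n with hmn | hmn
    · rw [← Y.incl_gN hmn, ← map_mul, ← map_mul, stepTr_incl hx, H.r1 m hmn a ha' b hb']
    · obtain rfl : n = m + 1 := by omega
      have := Sub_le_Bspan (Y.rep d (m + 1) u) (Nat.lt_succ_self m) hb'
      clear hb hb'
      induction this using Submodule.span_induction with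
      | mem b hb =>
        obtain ⟨c, hc, i, r, k, hir, rfl⟩ := hb
        have hT : Y.incl d (m + 1) u (pz (Y.tN d (m + 1) u i) k) = pz (Y.tN d (m + 2) u i) k := by
          rw [pz, map_pow, Y.incl_tN (by omega), pz]
        have e : Y.incl d (m + 1) u a * Y.gN d (m + 2) u m *
            Y.incl d (m + 1) u (c * W (Y.gN d (m + 1) u) i r * pz (Y.tN d (m + 1) u i) k) =
            Y.incl d (m + 1) u (a * c) * Y.gN d (m + 2) u m *
              (W (Y.gN d (m + 2) u) i r * pz (Y.tN d (m + 2) u i) k) := by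
          have hcc := Sub_comm_G (Y.rep d (m + 2) u) (Y.incl_mem (by omega) hc) le_rfl
            (show m + 1 < m + 2 by omega)
          simp only [map_mul, W_incl (show i + r < m + 1 by omega), hT]
          rw [mul_assoc _ (Y.incl d (m + 1) u c), hcc]
          simp only [mul_assoc]
        rw [e, stepTr_g φ _ hir]
        simp only [mul_assoc]
      | zero => simp
      | add b c _ _ h1 h2 => simp only [map_add, mul_add, h1, h2]
      | smul c b _ h1 => simp only [map_smul, mul_smul_comm, h1]
  r2 m hm a ha k := by
    obtain ⟨a, ha', rfl⟩ := Y.incl_Sub (by omega) ha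
    rw [stepTr_incl hx]
    rcases Nat.lt_or_ge m n with hmn | hmn
    · have hT : Y.incl d n u (pz (Y.tN d n u m) k) = pz (Y.tN d (n + 1) u m) k := by
        rw [pz, map_pow, Y.incl_tN (by omega), pz]
      rw [← hT, ← map_mul, stepTr_incl hx, H.r2 m hmn a ha']
    · obtain rfl : n = m := by omega
      exact stepTr_t φ a k

theorem stepTr_tracial (hx : x 0 = 1) {n : ℕ} (φ : Y d n u →ₗ[ℂ] R)
    (H : Rules n (Y.gN d n u) (Y.tN d n u) z x φ) (htr : ∀ a b, φ (a * b) = φ (b * a))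
    (a b : Y d (n + 1) u) : stepTr z x φ (a * b) = stepTr z x φ (b * a) := by
  refine tracial_step (Y.rep d (n + 1) u) (stepTr_rules hx φ H) ?_ (Y.mem_Sub a) (Y.mem_Sub b)
  intro a ha b hb
  obtain ⟨a, ha, rfl⟩ := Y.incl_Sub (by omega) ha
  obtain ⟨b, hb, rfl⟩ := Y.incl_Sub (by omega) hb
  rw [← map_mul, ← map_mul, stepTr_incl hx, stepTr_incl hx, htr]

theorem rep_zero (d : ℕ) (u : ℂ) : YRep d 0 u (fun _ => (0 : ℂ)) (fun _ => (0 : ℂ)) := by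
  constructor <;> intros <;> omega

/-- The traces, built strand by strand. -/
def trFam (d : ℕ) [NeZero d] (u : ℂ) {R : Type*} [CommRing R] [Algebra ℂ R] (z : R)
    (x : ZMod d → R) : ∀ n : ℕ, Y d n u →ₗ[ℂ] R
  | 0 => Algebra.linearMap ℂ R ∘ₗ (Y.lift (rep_zero d u)).toLinearMap
  | n + 1 => stepTr z x (trFam d u z x n)

theorem trFam_ok (hx : x 0 = 1) (n : ℕ) :
    Rules n (Y.gN d n u) (Y.tN d n u) z x (trFam d u z x n) ∧
    (∀ a b, trFam d u z x n (a * b) = trFam d u z x n (b * a)) ∧ trFam d u z x n 1 = 1 := by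
  induction n with
  | zero =>
    refine ⟨⟨by intros; omega, by intros; omega⟩, ?_, ?_⟩
    · intro a b
      simp [trFam, mul_comm]
    · simp [trFam]
  | succ n ih =>
    refine ⟨stepTr_rules hx _ ih.1, stepTr_tracial hx _ ih.1 ih.2.1, ?_⟩
    have := stepTr_incl (z := z) hx (trFam d u z x n) 1
    rw [map_one, ih.2.2] at this
    exact this

end construction

/- The Juyumaya trace, its specialization, and the Ocneanu trace. -/

section traces

/-- The parameters `x_1, …, x_{d-1}` extended by `x_0 = 1`, with indices modulo `d`. -/
def extParam {d : ℕ} {R : Type*} [CommRing R] (x : {m : ZMod d // m ≠ 0} → R) (m : ZMod d) : R :=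
  if h : m = 0 then 1 else x ⟨m, h⟩

/-- The quantity `E = (1/d) ∑ x_s x_{d-s}`. -/
def paramE {d : ℕ} [NeZero d] (x : {m : ZMod d // m ≠ 0} → ℂ) : ℂ :=
  (d : ℂ)⁻¹ * ∑ s : ZMod d, extParam x s * extParam x (-s)

/-- The complex numbers `x_1, …, x_{d-1}` solve the E-system. -/
def IsESolution {d : ℕ} [NeZero d] (x : {m : ZMod d // m ≠ 0} → ℂ) : Prop :=
  ∀ m : ZMod d, m ≠ 0 →
    ∑ s : ZMod d, extParam x (m + s) * extParam x (-s) =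
      extParam x m * ∑ s : ZMod d, extParam x s * extParam x (-s)

/-- The rules of the Juyumaya trace with parameters `z, x_1, …, x_{d-1}`. A linear map on the
union of the algebras is a family of linear maps compatible with the natural maps. -/
structure IsJuyumayaTrace (d : ℕ) (u : ℂ) {R : Type*} [CommRing R] [Algebra ℂ R] (z : R)
    (x : {m : ZMod d // m ≠ 0} → R) (tr : ∀ n, Y d n u →ₗ[ℂ] R) : Prop where
  incl : ∀ n a, tr (n + 1) (Y.incl d n u a) = tr n a
  comm : ∀ n a b, tr n (a * b) = tr n (b * a)
  one : ∀ n, tr n 1 = 1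
  markov : ∀ n a, tr (n + 2) (Y.incl d (n + 1) u a * Y.g d (n := n + 2) u (Fin.last n)) =
    z * tr (n + 1) a
  framing : ∀ n a (m : {m : ZMod d // m ≠ 0}),
    tr (n + 1) (Y.incl d n u a * Y.t d (n := n + 1) u (Fin.last n) ^ m.1.val) = x m * tr n a

theorem exists_isJuyumayaTrace (d : ℕ) [NeZero d] (u : ℂ) {R : Type*} [CommRing R] [Algebra ℂ R]
    (z : R) (x : {m : ZMod d // m ≠ 0} → R) :
    ∃ tr : ∀ n, Y d n u →ₗ[ℂ] R, IsJuyumayaTrace d u z x tr := by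
  have hx : extParam x 0 = 1 := by simp [extParam]
  refine ⟨trFam d u z (extParam x), fun n a => stepTr_incl hx _ a,
    fun n => (trFam_ok hx n).2.1, fun n => (trFam_ok hx n).2.2, fun n a => ?_, fun n a m => ?_⟩
  · have := (trFam_ok (u := u) (z := z) hx (n + 2)).1.r1 n (by omega) _
      (Y.incl_mem le_rfl (Y.mem_Sub a)) 1 (one_mem _)
    rw [mul_one, mul_one, Y.gN, dif_pos (by omega)] at this
    exact this.trans (congrArg _ (stepTr_incl hx _ a))
  · have := stepTr_t (z := z) (x := extParam x) (trFam d u z (extParam x) n) a m.1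
    rw [pz, Y.tN, dif_pos (by omega), extParam, dif_neg m.2] at this
    exact this

/-- The ring `ℂ[z, x_1, …, x_{d-1}]`; the variable `z` has the name `none`. -/
abbrev ParamRing (d : ℕ) : Type := MvPolynomial (Option {m : ZMod d // m ≠ 0}) ℂ

/-- The Juyumaya trace `tr`, with values in `ℂ[z, x_1, …, x_{d-1}]`. -/
def juyumayaTrace (d : ℕ) [NeZero d] (u : ℂ) : ∀ n, Y d n u →ₗ[ℂ] ParamRing d :=
  (exists_isJuyumayaTrace d u (R := ParamRing d) (MvPolynomial.X none)
    fun m => MvPolynomial.X (some m)).choose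

theorem juyumayaTrace_spec (d : ℕ) [NeZero d] (u : ℂ) :
    IsJuyumayaTrace d u (R := ParamRing d) (MvPolynomial.X none)
      (fun m => MvPolynomial.X (some m)) (juyumayaTrace d u) :=
  (exists_isJuyumayaTrace d u (R := ParamRing d) (MvPolynomial.X none)
    fun m => MvPolynomial.X (some m)).choose_spec

/-- The specialization map `θ`, sending `z` to `z` and the variable `x_m` to the number `x_m`. -/
def specMap {d : ℕ} (x : {m : ZMod d // m ≠ 0} → ℂ) : ParamRing d →ₐ[ℂ] Polynomial ℂ :=
  MvPolynomial.aeval fun o => match o with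
    | none => Polynomial.X
    | some m => Polynomial.C (x m)

/-- The specialized Juyumaya trace `tr_S = θ ∘ tr`, with values in `ℂ[z]`. -/
def specTrace {d : ℕ} [NeZero d] (u : ℂ) (x : {m : ZMod d // m ≠ 0} → ℂ) (n : ℕ) :
    Y d n u →ₗ[ℂ] Polynomial ℂ :=
  (specMap x).toLinearMap ∘ₗ juyumayaTrace d u n

theorem Hecke.mk_rel {n : ℕ} {q : ℂ} {a b : FreeAlgebra ℂ (Fin (n - 1))} (h : HeckeRel n q a b) :
    Hecke.mk n q a = Hecke.mk n q b := RingQuot.mkAlgHom_rel ℂ h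

/-- The natural map `H_n(q) → H_{n+1}(q)`, sending `G_i` to `G_i`. -/
def Hecke.incl (n : ℕ) (q : ℂ) : Hecke n q →ₐ[ℂ] Hecke (n + 1) q :=
  RingQuot.liftAlgHom ℂ ⟨FreeAlgebra.lift ℂ fun i =>
      Hecke.G (n := n + 1) q ⟨i, by omega⟩, by
    intro a b hab
    cases hab with
    | far i j h =>
      simpa [Hecke.G] using Hecke.mk_rel
        (HeckeRel.far (n := n + 1) (q := q) ⟨i, by omega⟩ ⟨j, by omega⟩ h)
    | braid i j h =>
      simpa [Hecke.G] using Hecke.mk_rel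
        (HeckeRel.braid (n := n + 1) (q := q) ⟨i, by omega⟩ ⟨j, by omega⟩ h)
    | quad i =>
      simpa [Hecke.G] using Hecke.mk_rel
        (HeckeRel.quad (n := n + 1) (q := q) ⟨i, by omega⟩)⟩

theorem Hecke.incl_G (n : ℕ) (q : ℂ) (i : Fin (n - 1)) :
    Hecke.incl n q (Hecke.G q i) = Hecke.G (n := n + 1) q ⟨i, by omega⟩ := by
  simp only [Hecke.incl, Hecke.G, Hecke.mk]
  erw [RingQuot.liftAlgHom_mkAlgHom_apply]
  simp [Hecke.G, Hecke.mk]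

/-- The rules of the Ocneanu trace with parameter `ζ`. -/
structure IsOcneanuTrace (q : ℂ) {R : Type*} [CommRing R] [Algebra ℂ R] (ζ : R)
    (τ : ∀ n, Hecke n q →ₗ[ℂ] R) : Prop where
  incl : ∀ n h, τ (n + 1) (Hecke.incl n q h) = τ n h
  comm : ∀ n h h', τ n (h * h') = τ n (h' * h)
  one : ∀ n, τ n 1 = 1
  markov : ∀ n h, τ (n + 2) (Hecke.incl (n + 1) q h * Hecke.G (n := n + 2) q (Fin.last n)) =
    ζ * τ (n + 1) h

/-- The natural map `H_n(q) → Y_{1,n}(q)`. -/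
def Hecke.toY (n : ℕ) (q : ℂ) : Hecke n q →ₐ[ℂ] Y 1 n q :=
  RingQuot.liftAlgHom ℂ ⟨FreeAlgebra.lift ℂ fun i => Y.gN 1 n q i, by
    intro a b hab
    have H := Y.rep 1 n q
    cases hab with
    | far i j h => simpa using H.far i j h (by omega)
    | braid i j h => simpa [h] using (H.braid i (by omega)).symm
    | quad i =>
      have hi : (i : ℕ) + 1 < n := by omega
      have ht : Y.tN 1 n q (i + 1) = 1 := by simpa using H.td (i + 1) hi
      have e : Y.gN 1 n q i * Y.gN 1 n q i = (q - 1) • Y.gN 1 n q i + q • 1 := by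
        rw [H.quad i hi, idem, ht]
        simp [sub_smul]
        abel
      simpa [pow_two, Algebra.algebraMap_eq_smul_one] using e⟩

theorem Hecke.toY_G (n : ℕ) (q : ℂ) (i : Fin (n - 1)) :
    Hecke.toY n q (Hecke.G q i) = Y.gN 1 n q i := by
  simp only [Hecke.toY, Hecke.G, Hecke.mk]
  erw [RingQuot.liftAlgHom_mkAlgHom_apply]
  simp

theorem Hecke.hom_ext {n : ℕ} {q : ℂ} {A : Type*} [Ring A] [Algebra ℂ A]
    {f f' : Hecke n q →ₐ[ℂ] A} (h : ∀ i, f (Hecke.G q i) = f' (Hecke.G q i)) : f = f' := by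
  refine RingQuot.ringQuot_ext' ℂ f f' (FreeAlgebra.hom_ext (funext fun i => h i))

theorem Hecke.toY_incl (n : ℕ) (q : ℂ) (h : Hecke n q) :
    Hecke.toY (n + 1) q (Hecke.incl n q h) = Y.incl 1 n q (Hecke.toY n q h) := by
  have : (Hecke.toY (n + 1) q).comp (Hecke.incl n q) = (Y.incl 1 n q).comp (Hecke.toY n q) := by
    refine Hecke.hom_ext fun i => ?_
    rw [AlgHom.comp_apply, AlgHom.comp_apply, Hecke.incl_G, Hecke.toY_G, Hecke.toY_G,
      Y.incl_gN (by omega)]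
  exact DFunLike.congr_fun this h

theorem exists_isOcneanuTrace (q : ℂ) {R : Type*} [CommRing R] [Algebra ℂ R] (ζ : R) :
    ∃ τ : ∀ n, Hecke n q →ₗ[ℂ] R, IsOcneanuTrace q ζ τ := by
  obtain ⟨tr, H⟩ := exists_isJuyumayaTrace 1 q (R := R) ζ fun _ => 0
  refine ⟨fun n => tr n ∘ₗ (Hecke.toY n q).toLinearMap, fun n h => ?_, fun n h h' => ?_,
    fun n => ?_, fun n h => ?_⟩
  · simp [Hecke.toY_incl, H.incl]
  · simpa using H.comm n _ _
  · simpa using H.one n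
  · have e : Hecke.toY (n + 2) q (Hecke.G (n := n + 2) q (Fin.last n)) =
        Y.g 1 (n := n + 2) q (Fin.last n) := by
      rw [Hecke.toY_G, Y.gN, dif_pos (show ((Fin.last n : Fin (n + 1)) : ℕ) < n + 2 - 1 from (Fin.last n).2)]
      rfl
    simp only [LinearMap.comp_apply, AlgHom.toLinearMap_apply, map_mul, Hecke.toY_incl]
    rw [e]
    exact H.markov n _

/-- The Ocneanu trace `τ`, with values in `ℂ[ζ]`. -/
def ocneanuTrace (q : ℂ) : ∀ n, Hecke n q →ₗ[ℂ] Polynomial ℂ :=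
  (exists_isOcneanuTrace q (R := Polynomial ℂ) Polynomial.X).choose

theorem ocneanuTrace_spec (q : ℂ) :
    IsOcneanuTrace q (R := Polynomial ℂ) Polynomial.X (ocneanuTrace q) :=
  (exists_isOcneanuTrace q (R := Polynomial ℂ) Polynomial.X).choose_spec

end traces

section braids

theorem Hecke.G_sq {n : ℕ} (q : ℂ) (i : Fin (n - 1)) :
    Hecke.G q i * Hecke.G q i = (q - 1) • Hecke.G q i + algebraMap ℂ (Hecke n q) q := by
  have := RingQuot.mkAlgHom_rel ℂ (HeckeRel.quad (n := n) (q := q) i)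
  rw [map_pow, pow_two, map_add, map_smul, AlgHom.commutes] at this
  exact this

/-- The generator `G_i` as a unit, with inverse `q⁻¹ G_i + (q⁻¹ - 1)`. -/
def Hecke.unitG {n : ℕ} {q : ℂ} (hq : q ≠ 0) (i : Fin (n - 1)) : (Hecke n q)ˣ where
  val := Hecke.G q i
  inv := q⁻¹ • Hecke.G q i + algebraMap ℂ (Hecke n q) (q⁻¹ - 1)
  val_inv := by
    rw [mul_add, mul_smul_comm, Hecke.G_sq, Algebra.algebraMap_eq_smul_one,
      Algebra.algebraMap_eq_smul_one, mul_smul_comm, mul_one, smul_add, smul_smul, smul_smul,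
      inv_mul_cancel₀ hq, mul_sub, inv_mul_cancel₀ hq, sub_smul, sub_smul]
    simp
    abel
  inv_val := by
    rw [add_mul, smul_mul_assoc, Hecke.G_sq, Algebra.algebraMap_eq_smul_one,
      Algebra.algebraMap_eq_smul_one, smul_mul_assoc, one_mul, smul_add, smul_smul, smul_smul,
      inv_mul_cancel₀ hq, mul_sub, inv_mul_cancel₀ hq, sub_smul, sub_smul]
    simp
    abel

/-- The group homomorphism out of the braid group given by elements satisfying the braid
relations. -/
def BraidGroup.lift {n : ℕ} {M : Type*} [Group M] (f : Fin (n - 1) → M)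
    (far : ∀ i j : Fin (n - 1), (i : ℕ) + 1 < j → f i * f j = f j * f i)
    (braid : ∀ i j : Fin (n - 1), (j : ℕ) = i + 1 → f j * f i * f j = f i * f j * f i) :
    BraidGroup n →* M :=
  PresentedGroup.toGroup (rels := {r | BraidRel n r}) (f := f) (by
    intro r hr
    cases hr with
    | far i j h =>
      rw [map_mul, map_inv, mul_inv_eq_one]
      simpa using far i j h
    | braid i j h =>
      rw [map_mul, map_inv, mul_inv_eq_one]
      simpa using braid i j h)

theorem BraidGroup.lift_σ {n : ℕ} {M : Type*} [Group M] (f : Fin (n - 1) → M)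
    (far : ∀ i j : Fin (n - 1), (i : ℕ) + 1 < j → f i * f j = f j * f i)
    (braid : ∀ i j : Fin (n - 1), (j : ℕ) = i + 1 → f j * f i * f j = f i * f j * f i)
    (i : Fin (n - 1)) : BraidGroup.lift f far braid (σ i) = f i :=
  PresentedGroup.toGroup.of _

/-- The natural algebra epimorphism `π : ℂB_n → H_n(q)`, sending `σ_i` to `G_i`. -/
def piMap (n : ℕ) {q : ℂ} (hq : q ≠ 0) : MonoidAlgebra ℂ (BraidGroup n) →ₐ[ℂ] Hecke n q :=
  MonoidAlgebra.lift ℂ _ _ ((Units.coeHom (Hecke n q)).comp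
    (BraidGroup.lift (fun i => Hecke.unitG hq i)
      (fun i j h => Units.ext (by
        have := RingQuot.mkAlgHom_rel ℂ (HeckeRel.far (n := n) (q := q) i j h)
        rwa [map_mul, map_mul] at this))
      (fun i j h => Units.ext (by
        have := RingQuot.mkAlgHom_rel ℂ (HeckeRel.braid (n := n) (q := q) i j h)
        rwa [map_mul, map_mul, map_mul, map_mul] at this))))

theorem piMap_σ (n : ℕ) {q : ℂ} (hq : q ≠ 0) (i : Fin (n - 1)) :
    piMap n hq (MonoidAlgebra.of ℂ (BraidGroup n) (σ i)) = Hecke.G q i := by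
  rw [piMap, MonoidAlgebra.lift_of, MonoidHom.comp_apply, BraidGroup.lift_σ]
  rfl

theorem idem_sq {A : Type*} [Ring A] [Algebra ℂ A] {d : ℕ} [NeZero d] {a b : A} (ha : a ^ d = 1)
    (hb : b ^ d = 1) (h : a * b = b * a) : idem d a b * idem d a b = idem d a b := by
  have hs : ∀ s : ℕ, idem d a b * a ^ s = idem d a b * b ^ s := by
    intro s
    induction s with
    | zero => simp
    | succ s ih =>
      have hc : a ^ s * b = b * a ^ s := (Commute.pow_left h s).eq
      rw [pow_succ', ← mul_assoc, idem_mul_self ha hb h, mul_assoc, ← hc, ← mul_assoc, ih,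
        pow_succ, mul_assoc]
  conv_lhs => enter [2]; rw [idem]
  rw [mul_smul_comm, Finset.mul_sum, Finset.sum_congr rfl (g := fun _ => idem d a b)]
  · rw [Finset.sum_const, Finset.card_range, ← Nat.cast_smul_eq_nsmul ℂ, smul_smul,
      inv_mul_cancel₀ (by exact_mod_cast NeZero.ne d), one_smul]
  · intro s hs'
    rw [← mul_assoc, hs, mul_assoc, ← pow_add,
      Nat.add_sub_cancel' (by simpa using (Finset.mem_range.1 hs').le), hb, mul_one]

theorem YRep.inv {d n : ℕ} [NeZero d] {u : ℂ} (hu : u ≠ 0) {A : Type*} [Ring A] [Algebra ℂ A]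
    {G T : ℕ → A} (h : YRep d n u G T) {i : ℕ} (hi : i + 1 < n) :
    G i * (G i + (u⁻¹ - 1) • idem d (T i) (T (i + 1)) +
      (u⁻¹ - 1) • (idem d (T i) (T (i + 1)) * G i)) = 1 ∧
    (G i + (u⁻¹ - 1) • idem d (T i) (T (i + 1)) +
      (u⁻¹ - 1) • (idem d (T i) (T (i + 1)) * G i)) * G i = 1 := by
  have c := e_comm_G h hi
  have e := idem_sq (h.td i (by omega)) (h.td _ hi) (h.tt i (i + 1) (by omega) hi)
  have q := h.quad i hi
  set E := idem d (T i) (T (i + 1))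
  have q' : E * (G i * G i) = u • E + (u - 1) • (E * G i) := by
    rw [q]
    simp only [mul_add, mul_one, mul_smul_comm, ← mul_assoc, e]
    rw [sub_smul u 1 E, one_smul]
    abel
  have key : G i * G i + (u⁻¹ - 1) • (E * G i) + (u⁻¹ - 1) • (E * (G i * G i)) = 1 := by
    rw [q', q]
    have h1 : (u⁻¹ - 1) * u = -(u - 1) := by field_simp; ring
    have h2 : (u⁻¹ - 1) + (u⁻¹ - 1) * (u - 1) = -(u - 1) := by field_simp; ring
    have h3 : (u⁻¹ - 1) • (u • E + (u - 1) • (E * G i)) + (u⁻¹ - 1) • (E * G i) =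
        -((u - 1) • E) - (u - 1) • (E * G i) := by
      rw [smul_add, smul_smul, smul_smul, h1, add_assoc, ← add_smul, add_comm _ (u⁻¹ - 1), h2]
      simp only [neg_smul, sub_eq_add_neg]
    rw [add_assoc, add_comm ((u⁻¹ - 1) • (E * G i)), h3]
    abel
  constructor
  · rw [mul_add, mul_add, mul_smul_comm, mul_smul_comm, ← mul_assoc (G i), ← c, mul_assoc]
    exact key
  · rw [add_mul, add_mul, smul_mul_assoc, smul_mul_assoc, mul_assoc]
    exact key

/-- The generator `g_i` as a unit, with inverse `g_i + (u⁻¹ - 1) e_i + (u⁻¹ - 1) e_i g_i`. -/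
def Y.unitG (d : ℕ) [NeZero d] {n : ℕ} {u : ℂ} (hu : u ≠ 0) (i : Fin (n - 1)) : (Y d n u)ˣ where
  val := Y.gN d n u i
  inv := Y.gN d n u i + (u⁻¹ - 1) • idem d (Y.tN d n u i) (Y.tN d n u (i + 1)) +
    (u⁻¹ - 1) • (idem d (Y.tN d n u i) (Y.tN d n u (i + 1)) * Y.gN d n u i)
  val_inv := ((Y.rep d n u).inv hu (by omega)).1
  inv_val := ((Y.rep d n u).inv hu (by omega)).2

/-- The natural algebra homomorphism `δ : ℂB_n → Y_{d,n}(u)`, sending `σ_i` to `g_i`. -/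
def deltaMap (d : ℕ) [NeZero d] (n : ℕ) {u : ℂ} (hu : u ≠ 0) :
    MonoidAlgebra ℂ (BraidGroup n) →ₐ[ℂ] Y d n u :=
  MonoidAlgebra.lift ℂ _ _ ((Units.coeHom (Y d n u)).comp
    (BraidGroup.lift (fun i => Y.unitG d hu i)
      (fun i j h => Units.ext ((Y.rep d n u).far i j h (by omega)))
      (fun i j h => Units.ext (by
        have := (Y.rep d n u).braid i (by omega)
        rw [← h] at this
        exact this.symm))))

theorem deltaMap_σ (d : ℕ) [NeZero d] (n : ℕ) {u : ℂ} (hu : u ≠ 0) (i : Fin (n - 1)) :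
    deltaMap d n hu (MonoidAlgebra.of ℂ (BraidGroup n) (σ i)) = Y.g d u i := by
  rw [deltaMap, MonoidAlgebra.lift_of, MonoidHom.comp_apply, BraidGroup.lift_σ]
  change Y.gN d n u i = _
  rw [Y.gN, dif_pos i.2]

end braids

end YokonumaHecke

end

/-!
A solution of the E-system with `E = 1` is a character of `ℤ/d`. Indeed, the E-system together with
`E = 1` says that the extended family `x` satisfies `x * x = d x` for convolution, so every value of
its discrete Fourier transform is `0` or `d`; by Fourier inversion at `0` these values sum to
`d x₀ = d`, so exactly one of them is non-zero and `x_m = c ^ m` for some `c` with `c ^ d = 1`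
(`exists_extParam_eq_pow`).

For such a `c`, sending `g_i ↦ G_i` and `t_j ↦ c` defines an algebra homomorphism
`Y_{d,n}(q) → H_n(q)` (`Y.toHecke`): each `e_i` is sent to `1`, which turns the quadratic relation
of the Yokonuma-Hecke algebra into the one of the Hecke algebra. The pullback of the Ocneanu trace
satisfies the rules of the Juyumaya trace at the parameters `z, c ^ m`, hence coincides with the
specialized trace, because the rules determine the trace (`IsJuyumayaTrace.unique`). Finally
`Y.toHecke ∘ δ = π`, since both homomorphisms send `σ_i` to `G_i`.
-/

namespace YokonumaHecke

/-! ### Solutions of the E-system with `E = 1` -/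

section characters

open ZMod

theorem extParam_zero {d : ℕ} {R : Type*} [CommRing R] (x : {m : ZMod d // m ≠ 0} → R) :
    extParam x 0 = 1 := by
  simp [extParam]

theorem IsESolution.convolution {d : ℕ} [NeZero d] {x : {m : ZMod d // m ≠ 0} → ℂ}
    (hx : IsESolution x) (hE : paramE x = 1) (m : ZMod d) :
    ∑ s : ZMod d, extParam x (m - s) * extParam x s = d * extParam x m := by
  have hd : (d : ℂ) ≠ 0 := by exact_mod_cast NeZero.ne d
  have h0 : ∑ s : ZMod d, extParam x s * extParam x (-s) = d := by
    rw [paramE, inv_mul_eq_one₀ hd] at hE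
    exact hE.symm
  have hneg : ∑ s : ZMod d, extParam x (m - s) * extParam x s =
      ∑ s : ZMod d, extParam x (m + s) * extParam x (-s) :=
    Fintype.sum_equiv (Equiv.neg _) _ _ fun s => by simp [sub_eq_add_neg]
  rw [hneg]
  by_cases hm : m = 0
  · simp [hm, h0, extParam_zero]
  · rw [hx m hm, h0, mul_comm]

/-- If `y * y = d y` for convolution on `ℤ/d` and `y 0 = 1`, then `y` is a character: its Fourier
transform takes only the values `0` and `d`, and the value `d` exactly once. -/
theorem exists_eq_stdAddChar_of_convolution {d : ℕ} [NeZero d] {y : ZMod d → ℂ} (h0 : y 0 = 1)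
    (hy : ∀ m, ∑ s, y (m - s) * y s = d * y m) :
    ∃ k : ZMod d, ∀ m, y m = stdAddChar (k * m) := by
  have hd : (d : ℂ) ≠ 0 := by exact_mod_cast NeZero.ne d
  have hsq : ∀ k, 𝓕 y k * 𝓕 y k = d * 𝓕 y k := by
    intro k
    simp only [dft_apply, smul_eq_mul]
    rw [Finset.sum_mul_sum, Finset.sum_comm, Finset.mul_sum]
    calc ∑ b : ZMod d, ∑ a : ZMod d,
          stdAddChar (-(a * k)) * y a * (stdAddChar (-(b * k)) * y b)
        = ∑ b : ZMod d, ∑ m : ZMod d, stdAddChar (-(m * k)) * (y (m - b) * y b) := by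
          refine Finset.sum_congr rfl fun b _ =>
            Fintype.sum_equiv (Equiv.addRight b) _ _ fun a => ?_
          have e : -((a + b) * k) = -(a * k) + -(b * k) := by ring
          rw [Equiv.coe_addRight, e, AddChar.map_add_eq_mul, add_sub_cancel_right]
          ring
      _ = _ := by
          rw [Finset.sum_comm]
          refine Finset.sum_congr rfl fun m _ => ?_
          rw [← Finset.mul_sum, hy]
          ring
  have hval : ∀ k, 𝓕 y k = if 𝓕 y k = 0 then 0 else (d : ℂ) := by
    intro k
    split_ifs with h
    · exact h
    · exact mul_right_cancel₀ h (hsq k)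
  have hinv : ∀ m, y m = (d : ℂ)⁻¹ * ∑ k, stdAddChar (k * m) * 𝓕 y k := by
    intro m
    have := invDFT_apply (𝓕 y) m
    rwa [LinearEquiv.symm_apply_apply] at this
  have hcard : (Finset.univ.filter fun k => ¬ 𝓕 y k = 0).card = 1 := by
    have h := hinv 0
    rw [h0, eq_comm, inv_mul_eq_one₀ hd] at h
    simp only [mul_zero, AddChar.map_zero_eq_one, one_mul] at h
    rw [Finset.sum_congr rfl fun k _ => hval k, Finset.sum_ite, Finset.sum_const_zero, zero_add,
      Finset.sum_const, nsmul_eq_mul] at h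
    exact_mod_cast (mul_right_cancel₀ hd ((one_mul _).trans h)).symm
  obtain ⟨k, hk⟩ := Finset.card_eq_one.1 hcard
  have hk' : ∀ l, 𝓕 y l ≠ 0 ↔ l = k := fun l => by
    simpa using congrArg (l ∈ ·) hk
  refine ⟨k, fun m => ?_⟩
  rw [hinv m, Finset.sum_eq_single k, hval k, if_neg ((hk' k).2 rfl)]
  · field_simp
  · intro l _ hl
    rw [not_not.1 (mt (hk' l).1 hl), mul_zero]
  · simp

theorem exists_extParam_eq_pow {d : ℕ} [NeZero d] {x : {m : ZMod d // m ≠ 0} → ℂ}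
    (hx : IsESolution x) (hE : paramE x = 1) :
    ∃ c : ℂ, c ^ d = 1 ∧ ∀ m : ZMod d, extParam x m = c ^ m.val := by
  obtain ⟨k, hk⟩ := exists_eq_stdAddChar_of_convolution (extParam_zero x) (hx.convolution hE)
  refine ⟨stdAddChar k, ?_, fun m => ?_⟩
  · rw [← AddChar.map_nsmul_eq_pow]
    simp
  · rw [hk, ← AddChar.map_nsmul_eq_pow, nsmul_eq_mul, ZMod.natCast_zmod_val, mul_comm]

end characters

/-! ### Uniqueness of the Juyumaya trace -/

/-- The rules of the Juyumaya trace determine it: `Y_{d,n+1}(u)` is spanned by the elements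
`a t_{n+1}^k` and `a g_n b` with `a` and `b` in `Y_{d,n}(u)`. -/
theorem IsJuyumayaTrace.unique {d : ℕ} [NeZero d] {u : ℂ} {R : Type*} [CommRing R] [Algebra ℂ R]
    {z : R} {x : {m : ZMod d // m ≠ 0} → R} {tr tr' : ∀ n, Y d n u →ₗ[ℂ] R}
    (h : IsJuyumayaTrace d u z x tr) (h' : IsJuyumayaTrace d u z x tr') (n : ℕ) :
    tr n = tr' n := by
  have hlast : ∀ m : ℕ, Y.g d (n := m + 2) u (Fin.last m) = Y.gN d (m + 2) u m := fun m => by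
    rw [Y.gN, dif_pos (by omega)]
    rfl
  induction n with
  | zero =>
    have hscalar : ∀ y : Y d 0 u, ∃ c : ℂ, y = algebraMap ℂ _ c := by
      intro y
      induction y using Y.ind with
      | halg c => exact ⟨c, rfl⟩
      | hg i hi => omega
      | ht j hj => omega
      | hadd a b ha hb =>
        obtain ⟨c, rfl⟩ := ha
        obtain ⟨c', rfl⟩ := hb
        exact ⟨c + c', (map_add _ _ _).symm⟩
      | hmul a b ha hb =>
        obtain ⟨c, rfl⟩ := ha
        obtain ⟨c', rfl⟩ := hb
        exact ⟨c * c', (map_mul _ _ _).symm⟩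
    ext y
    obtain ⟨c, rfl⟩ := hscalar y
    rw [Algebra.algebraMap_eq_smul_one, map_smul, map_smul, h.one, h'.one]
  | succ n ih =>
    ext y
    have hy := Sub_le_Bspan (Y.rep d (n + 1) u) (Nat.lt_succ_self n) (Y.mem_Sub y)
    induction hy using Submodule.span_induction with
    | zero => simp
    | add a b _ _ ha hb => rw [map_add, map_add, ha, hb]
    | smul c a _ ha => rw [map_smul, map_smul, ha]
    | mem y hy =>
      obtain ⟨_, ha, i, r, k, hir, rfl⟩ := hy
      obtain ⟨a, -, rfl⟩ := Y.incl_Sub (Nat.le_refl n) ha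
      cases r with
      | zero =>
        obtain rfl : i = n := by omega
        by_cases hk : k = 0
        · simp only [hk, W, mul_one, pz_zero, h.incl, h'.incl, ih]
        · have e : pz (Y.tN d (i + 1) u i) k =
              Y.t d (n := i + 1) u (Fin.last i) ^ (⟨k, hk⟩ : {m : ZMod d // m ≠ 0}).1.val := by
            rw [pz, Y.tN, dif_pos (by omega)]
            rfl
          rw [W, mul_one, e, h.framing, h'.framing, ih]
      | succ r =>
        obtain ⟨n, rfl⟩ : ∃ m, n = m + 1 := ⟨i + r, by omega⟩
        obtain rfl : i + r = n := by omega
        -- The part of the word after `g_n` lies in the smaller algebra; cyclicity moves it in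
        -- front, where the Markov rule applies.
        have hb : W (Y.gN d (i + r + 2) u) i r * pz (Y.tN d (i + r + 2) u i) k ∈
            Sub (Y.gN d (i + r + 2) u) (Y.tN d (i + r + 2) u) (i + r + 1) :=
          mul_mem (W_mem _ _ _ (by omega)) (pz_mem (by omega) k)
        obtain ⟨b, -, hb⟩ := Y.incl_Sub le_rfl hb
        rw [W_top, ← hlast, mul_assoc, mul_assoc, ← hb, ← mul_assoc, h.comm, h'.comm, ← mul_assoc,
          ← map_mul, h.markov, h'.markov, ih]

theorem specTrace_isJuyumayaTrace {d : ℕ} [NeZero d] (u : ℂ) (x : {m : ZMod d // m ≠ 0} → ℂ) :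
    IsJuyumayaTrace d u (R := Polynomial ℂ) Polynomial.X (fun m => Polynomial.C (x m))
      (specTrace u x) := by
  have H := juyumayaTrace_spec d u
  refine ⟨fun n a => ?_, fun n a b => ?_, fun n => ?_, fun n a => ?_, fun n a m => ?_⟩
  · simp [specTrace, H.incl]
  · simp [specTrace, H.comm n a b]
  · simp [specTrace, H.one]
  · simp [specTrace, H.markov, specMap]
  · simp [specTrace, H.framing, specMap]

/-! ### From the Yokonuma-Hecke algebra to the Hecke algebra -/

section toHecke

variable {d : ℕ} {q c : ℂ}

/-- The generator `G_i` of `H_n(q)` with a total index, equal to `0` out of range. -/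
noncomputable def Hecke.GN (n : ℕ) (q : ℂ) (i : ℕ) : Hecke n q :=
  if h : i < n - 1 then Hecke.G q ⟨i, h⟩ else 0

theorem Hecke.GN_coe {n : ℕ} (i : Fin (n - 1)) : Hecke.GN n q i = Hecke.G q i :=
  dif_pos i.2

theorem idem_algebraMap [NeZero d] {A : Type*} [Ring A] [Algebra ℂ A] (hc : c ^ d = 1) :
    idem d (algebraMap ℂ A c) (algebraMap ℂ A c) = 1 := by
  have hd : (d : ℂ) ≠ 0 := by exact_mod_cast NeZero.ne d
  have h : ∀ s ∈ Finset.range d, algebraMap ℂ A c ^ s * algebraMap ℂ A c ^ (d - s) = 1 := by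
    intro s hs
    rw [← pow_add, Nat.add_sub_cancel' (Finset.mem_range.1 hs).le, ← map_pow, hc, map_one]
  rw [idem, Finset.sum_congr rfl h, Finset.sum_const, Finset.card_range,
    ← Nat.cast_smul_eq_nsmul ℂ, smul_smul, inv_mul_cancel₀ hd, one_smul]

theorem Hecke.yRep [NeZero d] (n : ℕ) (q : ℂ) (hc : c ^ d = 1) :
    YRep d n q (Hecke.GN n q) (fun _ => algebraMap ℂ (Hecke n q) c) where
  far i j h1 h2 := by
    rw [Hecke.GN, Hecke.GN, dif_pos (by omega), dif_pos (by omega)]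
    simpa [Hecke.G] using
      Hecke.mk_rel (HeckeRel.far (q := q) (n := n) ⟨i, by omega⟩ ⟨j, by omega⟩ h1)
  braid i h := by
    rw [Hecke.GN, Hecke.GN, dif_pos (by omega), dif_pos (by omega)]
    simpa [Hecke.G] using
      (Hecke.mk_rel (HeckeRel.braid (q := q) (n := n) ⟨i, by omega⟩ ⟨i + 1, by omega⟩ rfl)).symm
  tt _ _ _ _ := rfl
  tg i _ _ _ _ _ := Algebra.commutes c _
  tg0 i _ := Algebra.commutes c _
  tg1 i _ := Algebra.commutes c _
  td _ _ := by rw [← map_pow, hc, map_one]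
  quad i h := by
    rw [idem_algebraMap hc, one_mul, Hecke.GN, dif_pos (by omega), Hecke.G_sq,
      Algebra.algebraMap_eq_smul_one, sub_smul q 1 (1 : Hecke n q), one_smul]
    abel

/-- For `c ^ d = 1`, the homomorphism `Y_{d,n}(q) → H_n(q)` with `g_i ↦ G_i` and `t_j ↦ c`. -/
noncomputable def Y.toHecke [NeZero d] (n : ℕ) (q : ℂ) (hc : c ^ d = 1) :
    Y d n q →ₐ[ℂ] Hecke n q :=
  Y.lift (Hecke.yRep n q hc)

theorem Y.toHecke_g [NeZero d] {n : ℕ} (hc : c ^ d = 1) (i : Fin (n - 1)) :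
    Y.toHecke n q hc (Y.g d q i) = Hecke.G q i := by
  rw [Y.toHecke, Y.lift_g, Hecke.GN_coe]

theorem Y.toHecke_t [NeZero d] {n : ℕ} (hc : c ^ d = 1) (j : Fin n) :
    Y.toHecke n q hc (Y.t d q j) = algebraMap ℂ _ c := by
  rw [Y.toHecke, Y.lift_t]

theorem Y.toHecke_incl [NeZero d] {n : ℕ} (hc : c ^ d = 1) (a : Y d n q) :
    Y.toHecke (n + 1) q hc (Y.incl d n q a) = Hecke.incl n q (Y.toHecke n q hc a) := by
  induction a using Y.ind with
  | halg r => simp only [AlgHom.commutes]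
  | hg i hi =>
    rw [Y.gN, dif_pos (by omega), Y.incl_g, Y.toHecke_g, Y.toHecke_g, Hecke.incl_G]
  | ht j hj =>
    rw [Y.tN, dif_pos hj, Y.incl_t, Y.toHecke_t, Y.toHecke_t, AlgHom.commutes]
  | hadd a b ha hb => simp only [map_add, ha, hb]
  | hmul a b ha hb => simp only [map_mul, ha, hb]

theorem IsOcneanuTrace.comp_toHecke [NeZero d] {R : Type*} [CommRing R] [Algebra ℂ R] {ζ : R}
    {τ : ∀ n, Hecke n q →ₗ[ℂ] R} (H : IsOcneanuTrace q ζ τ) (hc : c ^ d = 1) :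
    IsJuyumayaTrace d q ζ (fun m => algebraMap ℂ R (c ^ m.1.val))
      (fun n => τ n ∘ₗ (Y.toHecke n q hc).toLinearMap) where
  incl n a := by
    simp only [LinearMap.comp_apply, AlgHom.toLinearMap_apply, Y.toHecke_incl, H.incl]
  comm n a b := by
    simp only [LinearMap.comp_apply, AlgHom.toLinearMap_apply, map_mul,
      H.comm n _ (Y.toHecke n q hc b)]
  one n := by
    simp only [LinearMap.comp_apply, AlgHom.toLinearMap_apply, map_one, H.one]
  markov n a := by
    simp only [LinearMap.comp_apply, AlgHom.toLinearMap_apply, map_mul, Y.toHecke_incl,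
      Y.toHecke_g, H.markov]
  framing n a m := by
    simp only [LinearMap.comp_apply, AlgHom.toLinearMap_apply, map_mul, map_pow, Y.toHecke_incl,
      Y.toHecke_t]
    rw [← map_pow, ← Algebra.commutes, ← Algebra.smul_def, map_smul, H.incl, Algebra.smul_def,
      map_pow]

theorem BraidGroup.hom_ext {n : ℕ} {M : Type*} [Monoid M] {f f' : BraidGroup n →* M}
    (h : ∀ i, f (σ i) = f' (σ i)) : f = f' := by
  refine MonoidHom.eq_of_eqOn_dense (PresentedGroup.closure_range_of {r | BraidRel n r}) ?_
  rintro _ ⟨i, rfl⟩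
  exact h i

theorem Y.toHecke_deltaMap [NeZero d] {n : ℕ} (hq : q ≠ 0) (hc : c ^ d = 1)
    (a : MonoidAlgebra ℂ (BraidGroup n)) :
    Y.toHecke n q hc (deltaMap d n hq a) = piMap n hq a := by
  have h : (Y.toHecke n q hc).comp (deltaMap d n hq) = piMap n hq := by
    refine MonoidAlgebra.algHom_ext' ?_ (Subsingleton.elim _ _)
    refine BraidGroup.hom_ext fun i => ?_
    have e := congrArg (Y.toHecke n q hc) (deltaMap_σ d n hq i)
    rw [Y.toHecke_g] at e
    exact e.trans (piMap_σ n hq i).symm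
  exact DFunLike.congr_fun h a

end toHecke

end YokonumaHecke

theorem mainTheorem8 (d : ℕ) [NeZero d] (q u : ℂ) (hq : q ≠ 0) (hu : u ≠ 0)
    (x : {m : ZMod d // m ≠ 0} → ℂ) (hx : YokonumaHecke.IsESolution x)
    (hE : YokonumaHecke.paramE x = 1) (huq : u = q) (n : ℕ) (α : YokonumaHecke.BraidGroup n) :
    YokonumaHecke.ocneanuTrace q n
        (YokonumaHecke.piMap n hq (MonoidAlgebra.of ℂ (YokonumaHecke.BraidGroup n) α)) =
      YokonumaHecke.specTrace u x n
        (YokonumaHecke.deltaMap d n hu (MonoidAlgebra.of ℂ (YokonumaHecke.BraidGroup n) α)) := by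
  subst huq
  obtain ⟨c, hc, hxc⟩ := YokonumaHecke.exists_extParam_eq_pow hx hE
  have H := (YokonumaHecke.ocneanuTrace_spec u).comp_toHecke (d := d) hc
  have hpar : (fun m : {m : ZMod d // m ≠ 0} => algebraMap ℂ (Polynomial ℂ) (c ^ m.1.val)) =
      fun m => Polynomial.C (x m) := by
    funext m
    rw [← hxc, YokonumaHecke.extParam, dif_neg m.2]
    rfl
  rw [hpar] at H
  rw [← H.unique (YokonumaHecke.specTrace_isJuyumayaTrace u x) n, LinearMap.comp_apply,
    AlgHom.toLinearMap_apply, YokonumaHecke.Y.toHecke_deltaMap]
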